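/- **Setting.** Let $\mathcal D(\mathbb R)$ be the complex-valued test functions, $\mathcal E(\mathbb R)=C^\infty(\mathbb R,\mathbb C)$, $\mathcal D'(\mathbb R)$ the Schwartz distributions and $\mathcal D'_+(\mathbb R)$ the distributions supported in $[0,\infty)$. For $\varphi\in\mathcal D(\mathbb R)$ let $R_\varphi=\sup\{|x|:\varphi(x)\neq0\}$ if $\varphi\ne0$, and $R_0=1$. Let $\mathcal D_0=\mathcal D(\mathbb R)$ and, for $n\ge1$, let $\mathcal D_n$ be the set of real-valued even $\varphi\in\mathcal D(\mathbb R)$ with $R_\varphi\le 1/n$, $\int\varphi=1$, $\int x^j\varphi(x)\,dx=0$ for $1\le j\le n$, $\int|\varphi|\le1+1/n$, and $\sup|\varphi^{(j)}|\le R_\varphi^{-2(j+1)}$ for $0\le j\le n$. Fix an ultrafilter $\mathcal U$ on $\mathcal D(\mathbb R)$ containing every $\mathcal D_n$; "a.e." means for all $\varphi$ in some member of $\mathcal U$. A net $(A_\varphi)$ in $\mathbb C$ is moderate if $|A_\varphi|\le R_\varphi^{-m}$ a.e. for some $m\in\mathbb N_0$, and negligible if $|A_\varphi|\le R_\varphi^{p}$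 a.e. for every $p\in\mathbb N_0$. A net $(f_\varphi)$ in $\mathcal E(\mathbb R)$ is moderate (negligible) if for every compact $K\subset\mathbb R$ and every $j\in\mathbb N_0$ the net $\sup_{x\in K}|f_\varphi^{(j)}(x)|$ is moderate (negligible). Let $\widehat{\mathbb C}$ (a field) and $\widehat{\mathcal E(\mathbb R)}$ (a differential algebra over $\widehat{\mathbb C}$, the Todorov–Vernaeve algebra) be the moderate nets modulo the negligible ones; $q$ denotes the class of a net. Derivatives and the value $y(0)\in\widehat{\mathbb C}$ are defined on representatives, and $\iota:\mathcal D'(\mathbb R)\to\widehat{\mathcal E(\mathbb R)}$ is $\iota(T)=q(T\star\varphi)$; smooth functions are regarded as distributions. Let $\widehat{\rm span}(\mathcal D'_+(\mathbb R))$ be the $\widehat{\mathbb C}$-linear span of $\iota(\mathcal D'_+(\mathbb R))$. For $T\in\mathcal D'_+(\mathbb R)$ and $f=\sum_{n}\alpha_n\iota(T_n)$ in this span (finite sum, $T_n\in\mathcal D'_+(\mathbb R)$, $\alpha_n\in\widehat{\mathbb C}$) put $T\star f=\sum_n\alpha_n\,\iota(T\star T_n)$; this does not depend on the representation of $f$.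 The Wronskian of $u_1,\dots,u_k\in\widehat{\mathcal E(\mathbb R)}$ is $W(u_1,\dots,u_k)=\det\big(u_n^{(i)}\big)_{0\le i<k,\,1\le n\le k}$. **Theorem.** Let $P\in\mathbb C[x]$ have degree $k$ and let $f\in\widehat{\rm span}(\mathcal D'_+(\mathbb R))$. Then the initial value problem $$P(d/dt)\,y=f,\qquad y(0)=y'(0)=\dots=y^{(k-1)}(0)=0$$ has a unique solution $y$ in $\widehat{\mathcal E(\mathbb R)}$. There is exactly one $G\in\mathcal D'_+(\mathbb R)$ with $P(d/dt)G=\delta$ (the Green function of $P(d/dt)$), and the homogeneous equation $P(d/dt)u=0$ has $k$ solutions in $\mathcal E(\mathbb R)$ that are linearly independent over $\mathbb C$. For any such $y_1,\dots,y_k$ one has $W(\iota(y_1),\dots,\iota(y_k))(0)\neq0$, and the solution of the initial value problem is $$y=\sum_{n=1}^k c_n\,\iota(y_n)+G\star f,\qquad c_n=-\frac{W\big(\iota(y_1),\dots,\iota(y_{n-1}),\,G\star f,\,\iota(y_{n+1}),\dots,\iota(y_k)\big)(0)}{W\big(\iota(y_1),\dots,\iota(y_k)\big)(0)}\in\widehat{\mathbb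 C}.$$ -/

import Mathlib

open scoped Distributions ContDiff Polynomial

noncomputable section

namespace TodorovVernaeve

/-- The space `𝓓(ℝ)` of complex-valued test functions on the line. -/
abbrev Test : Type := TestFunction (⊤ : TopologicalSpace.Opens ℝ) ℂ ⊤

/-- The space `𝓓'(ℝ)` of Schwartz distributions: continuous `ℂ`-linear forms on `𝓓(ℝ)`. -/
abbrev Distr : Type := Test →L[ℂ] ℂ

/-- The smooth functions from `ℝ` to `ℂ`, as a subalgebra of all functions. -/
def smoothSubalgebra : Subalgebra ℂ (ℝ → ℂ) where
  carrier := {f | ContDiff ℝ ∞ f}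
  mul_mem' {f g} (hf : ContDiff ℝ ∞ f) (hg : ContDiff ℝ ∞ g) := hf.mul hg
  add_mem' {f g} (hf : ContDiff ℝ ∞ f) (hg : ContDiff ℝ ∞ g) := hf.add hg
  algebraMap_mem' c := (contDiff_const : ContDiff ℝ ∞ fun _ : ℝ => c)

/-- The algebra `𝓔(ℝ)` of smooth functions from `ℝ` to `ℂ`. -/
def Smooth : Type := smoothSubalgebra

instance : CommRing Smooth := inferInstanceAs (CommRing smoothSubalgebra)

instance : Algebra ℂ Smooth := inferInstanceAs (Algebra ℂ smoothSubalgebra)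

instance : CoeFun Smooth (fun _ => ℝ → ℂ) := ⟨fun f => f.1⟩

theorem Smooth.smooth_coe (f : Smooth) : ContDiff ℝ ∞ (f : ℝ → ℂ) := f.2

theorem Smooth.diff_coe (f : Smooth) : Differentiable ℝ (f : ℝ → ℂ) :=
  (Smooth.smooth_coe f).differentiable (by simp)

/-- The derivative `d/dt` on `𝓔(ℝ)`. -/
def Smooth.D : Smooth →ₗ[ℂ] Smooth where
  toFun f := ⟨deriv (f : ℝ → ℂ), (contDiff_infty_iff_deriv.1 (Smooth.smooth_coe f)).2⟩
  map_add' f g := Subtype.ext <| funext fun x =>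
    deriv_add (Smooth.diff_coe f x) (Smooth.diff_coe g x)
  map_smul' c f := Subtype.ext <| funext fun x =>
    deriv_const_smul c (Smooth.diff_coe f x)

/-- The derivative of a distribution, `⟨T', φ⟩ = -⟨T, φ'⟩`. -/
def Distr.D : Distr →ₗ[ℂ] Distr where
  toFun T := -(T.comp (TestFunction.lineDerivCLM ℂ (1 : ℝ)))
  map_add' S T := by ext φ; simp; ring
  map_smul' c T := by ext φ; simp

/-- The Dirac distribution at the origin. -/
def Distr.dirac : Distr where
  toFun φ := φ 0
  map_add' _ _ := rfl
  map_smul' _ _ := rfl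
  cont := continuous_eval_const (0 : ℝ)

/-- The regular distribution `φ ↦ ∫ f φ` of a smooth function `f`. -/
def Distr.ofSmooth (f : Smooth) : Distr :=
  TestFunction.integralAgainstBilinCLM (ContinuousLinearMap.mul ℂ ℂ) MeasureTheory.volume (f : ℝ → ℂ)

theorem Distr.ofSmooth_apply (f : Smooth) (φ : Test) :
    Distr.ofSmooth f φ = ∫ x, φ x * (f : ℝ → ℂ) x := by
  refine TestFunction.integralAgainstBilinCLM_eq_integral ?_
  exact ((Smooth.smooth_coe f).continuous.locallyIntegrable).locallyIntegrableOn _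

/-- The space `𝓓'₊(ℝ)` of the distributions supported in `[0, ∞)`. -/
def DPlus : Submodule ℂ Distr where
  carrier := {T | Distribution.IsVanishingOn T (Set.Iio (0 : ℝ))}
  add_mem' hS hT φ h := by simp [hS φ h, hT φ h]
  zero_mem' φ h := by simp
  smul_mem' c T hT φ h := by simp [hT φ h]

/-- The test function `y ↦ φ (x - y)`. -/
def reflShift (x : ℝ) (φ : Test) : Test where
  toFun y := φ (x - y)
  contDiff' := φ.contDiff.comp (contDiff_const.sub contDiff_id)
  hasCompactSupport' := φ.hasCompactSupport.comp_homeomorph (Homeomorph.subLeft x)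
  tsupport_subset' _ _ := trivial

/-- The reflected test function `y ↦ φ (-y)`. -/
def refl (φ : Test) : Test := reflShift 0 φ

@[simp] theorem reflShift_apply (x : ℝ) (φ : Test) (y : ℝ) : reflShift x φ y = φ (x - y) := rfl

@[simp] theorem refl_apply (φ : Test) (y : ℝ) : refl φ y = φ (-y) := by simp [refl]

/-- the derivative of a test function -/
abbrev testD (φ : Test) : Test := TestFunction.lineDerivCLM ℂ (1 : ℝ) φ

theorem testD_apply (φ : Test) (x : ℝ) : testD φ x = deriv φ x := by
  simp [testD, lineDeriv, deriv_comp_const_add (φ : ℝ → ℂ) x 0]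

theorem coe_testD_iterate (φ : Test) (j : ℕ) : ⇑(testD^[j] φ) = iteratedDeriv j φ := by
  induction j with
  | zero => simp
  | succ j ih =>
    rw [Function.iterate_succ_apply', iteratedDeriv_succ, ← ih]
    exact funext (testD_apply _)

theorem Test.bounded (φ : Test) : ∃ C, 0 ≤ C ∧ ∀ x, ‖φ x‖ ≤ C := by
  obtain ⟨C, hC⟩ := φ.continuous.bounded_above_of_compact_support φ.hasCompactSupport
  exact ⟨C, (norm_nonneg _).trans (hC 0), hC⟩

/-- The defining estimate of a distribution: `|⟨T, φ⟩|` is controlled by finitely many derivatives,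
uniformly over the test functions vanishing off a fixed compact set. -/
theorem Distr.bound (T : Distr) {K : Set ℝ} (hK : IsCompact K) :
    ∃ (C : ℝ) (N : ℕ), 0 ≤ C ∧ ∀ φ : Test, (∀ x ∉ K, φ x = 0) → ∀ B : ℝ, 0 ≤ B →
      (∀ j ≤ N, ∀ x ∈ K, ‖iteratedDeriv j φ x‖ ≤ B) → ‖T φ‖ ≤ C * B := by
  let K' : TopologicalSpace.Compacts ℝ := ⟨K, hK⟩
  let L : ContDiffMapSupportedIn ℝ ℂ ⊤ K' →L[ℂ] ℂ :=
    T.comp (TestFunction.ofSupportedInCLM ℂ (K := K') (fun _ _ => trivial))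
  obtain ⟨s, C, -, hC⟩ := Seminorm.bound_of_continuous
    (ContDiffMapSupportedIn.withSeminorms ℂ ℝ ℂ ⊤ K')
    ((normSeminorm ℂ ℂ).comp L.toLinearMap) (by
      exact continuous_norm.comp L.continuous)
  refine ⟨C, s.sup id, C.2, fun φ hφ B hB h => ?_⟩
  let ψ : ContDiffMapSupportedIn ℝ ℂ ⊤ K' := ⟨φ, φ.contDiff, fun x hx => hφ x hx⟩
  have h1 : T φ = L ψ := rfl
  rw [h1]
  refine (hC ψ).trans ?_
  refine mul_le_mul_of_nonneg_left ?_ C.2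
  refine Seminorm.finset_sup_apply_le hB fun i hi => ?_
  rw [ContDiffMapSupportedIn.seminorm_top_le_iff ℂ hB]
  intro x hx
  rw [norm_iteratedFDeriv_eq_norm_iteratedDeriv]
  exact h i (Finset.le_sup (f := id) hi) x hx

theorem iteratedDeriv_coe_reflShift (x : ℝ) (φ : Test) (j : ℕ) (y : ℝ) :
    iteratedDeriv j (reflShift x φ) y = (-1) ^ j * (testD^[j] φ) (x - y) := by
  rw [coe_testD_iterate]
  have := congrFun (iteratedDeriv_comp_const_sub j (φ : ℝ → ℂ) x) y
  have h : ⇑(reflShift x φ) = fun z => φ (x - z) := rfl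
  rw [h]
  simpa using this

theorem Test.uniform_bound (φ : Test) (N : ℕ) :
    ∃ B, 0 ≤ B ∧ ∀ j ≤ N, ∀ x, ‖(testD^[j] φ) x‖ ≤ B := by
  choose C hC0 hC using fun j => Test.bounded (testD^[j] φ)
  refine ⟨∑ j ∈ Finset.range (N + 1), C j, Finset.sum_nonneg fun j _ => hC0 j, fun j hj x => ?_⟩
  exact (hC j x).trans (Finset.single_le_sum (fun j _ => hC0 j) (Finset.mem_range.2 (by omega)))

theorem Test.exists_radius (φ : Test) : ∃ R, 0 < R ∧ ∀ x, R < |x| → φ x = 0 := by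
  obtain ⟨R, hR0, hR⟩ := φ.hasCompactSupport.isCompact.isBounded.exists_pos_norm_le
  refine ⟨R, hR0, fun x hx => ?_⟩
  by_contra h
  exact absurd (hR x (subset_tsupport _ h)) (not_le.2 hx)

theorem Test.hasDerivAt (φ : Test) (x : ℝ) : HasDerivAt φ (testD φ x) x := by
  rw [testD_apply]
  exact (φ.contDiff.differentiable (by simp) x).hasDerivAt

theorem Test.zero_of_testD (φ : Test) {R : ℝ} (hR : ∀ x, R < |x| → φ x = 0) (j : ℕ) :
    ∀ x, R < |x| → (testD^[j] φ) x = 0 := by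
  induction j with
  | zero => exact hR
  | succ j ih =>
    intro x hx
    rw [Function.iterate_succ_apply', testD_apply]
    have : ⇑(testD^[j] φ) =ᶠ[nhds x] fun _ => 0 := by
      filter_upwards [(isOpen_lt continuous_const continuous_abs).mem_nhds hx] with y hy
      exact ih y hy
    rw [this.deriv_eq]
    simp

theorem Test.taylor (φ : Test) {M : ℝ} (hM : ∀ x, ‖testD (testD φ) x‖ ≤ M) (u h : ℝ) :
    ‖φ (u + h) - φ u - h * testD φ u‖ ≤ M * |h| * |h| := by
  have key : ∀ t ∈ segment ℝ u (u + h), ‖testD φ t - testD φ u‖ ≤ M * |h| := by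
    intro t ht
    have h1 := convex_univ.norm_image_sub_le_of_norm_hasDerivWithin_le (𝕜 := ℝ) (f := testD φ)
      (fun x _ => ((testD φ).hasDerivAt x).hasDerivWithinAt) (fun x _ => hM x)
      (Set.mem_univ u) (Set.mem_univ t)
    refine h1.trans (mul_le_mul_of_nonneg_left ?_ ((norm_nonneg _).trans (hM 0)))
    have := segment_eq_image' ℝ u (u + h) ▸ ht
    obtain ⟨θ, hθ, rfl⟩ := this
    simp only [add_sub_cancel_left, smul_eq_mul, Real.norm_eq_abs, abs_mul]
    rw [abs_of_nonneg hθ.1]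
    exact mul_le_of_le_one_left (abs_nonneg _) hθ.2
  have := (convex_segment u (u + h)).norm_image_sub_le_of_norm_hasDerivWithin_le (𝕜 := ℝ)
    (f := fun t : ℝ => φ t - (t : ℂ) * testD φ u) (f' := fun t => testD φ t - testD φ u)
    (fun t _ => by
      have h2 : HasDerivAt (fun t : ℝ => (t : ℂ) * testD φ u) (1 * testD φ u) t :=
        (Complex.ofRealCLM.hasDerivAt (x := t)).mul_const _
      rw [one_mul] at h2
      exact ((φ.hasDerivAt t).sub h2).hasDerivWithinAt)
    key (left_mem_segment ℝ u (u + h)) (right_mem_segment ℝ u (u + h))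
  simp only [add_sub_cancel_left, Real.norm_eq_abs] at this
  refine le_trans (le_of_eq ?_) this
  congr 1
  push_cast
  ring

/-- The value `(T ⋆ φ)(x) = ⟨T, φ(x - ·)⟩` is differentiable in `x`, with derivative
`(T ⋆ φ')(x)`. -/
theorem Distr.hasDerivAt_reflShift (T : Distr) (φ : Test) (x : ℝ) :
    HasDerivAt (fun x => T (reflShift x φ)) (T (reflShift x (testD φ))) x := by
  obtain ⟨R, hR0, hR⟩ := φ.exists_radius
  obtain ⟨C, N, hC0, hC⟩ := T.bound (isCompact_Icc (a := x - R - 1) (b := x + R + 1))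
  obtain ⟨M, hM0, hM⟩ := φ.uniform_bound (N + 2)
  rw [hasDerivAt_iff_isLittleO_nhds_zero]
  have hO : (fun h : ℝ => T (reflShift (x + h) φ) - T (reflShift x φ) -
      h • T (reflShift x (testD φ))) =O[nhds 0] fun h => h ^ 2 := by
    refine Asymptotics.IsBigO.of_bound (C * M) ?_
    filter_upwards [Metric.ball_mem_nhds (0 : ℝ) one_pos] with h hh
    have hh' : |h| < 1 := by simpa using hh
    let g : Test := reflShift (x + h) φ - reflShift x φ - (h : ℂ) • reflShift x (testD φ)
    have hg : T g = T (reflShift (x + h) φ) - T (reflShift x φ) -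
      h • T (reflShift x (testD φ)) := by simp [g]
    rw [← hg]
    have hB := hC g ?_ (M * |h| * |h|) (by positivity) ?_
    · refine hB.trans (le_of_eq ?_)
      rw [norm_pow, Real.norm_eq_abs]
      ring
    · intro y hy
      have hy' : y < x - R - 1 ∨ x + R + 1 < y := by
        by_contra hcon
        push Not at hcon
        exact hy hcon
      have h1 : R < |x + h - y| := by
        have := abs_lt.1 hh'
        rcases hy' with hy' | hy'
        · exact lt_of_lt_of_le (by linarith) (le_abs_self _)
        · exact lt_of_lt_of_le (by linarith) (neg_le_abs _)
      have h2 : R < |x - y| := by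
        rcases hy' with hy' | hy'
        · exact lt_of_lt_of_le (by linarith) (le_abs_self _)
        · exact lt_of_lt_of_le (by linarith) (neg_le_abs _)
      have h3 := φ.zero_of_testD hR 1 _ h2
      simp only [Function.iterate_one] at h3
      simp [g, hR _ h1, hR _ h2, h3]
    · intro j hj y _
      have e : iteratedDeriv j g y = (-1) ^ j * ((testD^[j] φ) (x - y + h) - (testD^[j] φ) (x - y)
          - h * testD (testD^[j] φ) (x - y)) := by
        have e1 : ⇑g = ⇑(reflShift (x + h) φ) - ⇑(reflShift x φ) -
          (h : ℂ) • ⇑(reflShift x (testD φ)) := by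
          ext y; simp [g]
        have cd : ∀ ψ : Test, ContDiffAt ℝ j ψ y := fun ψ =>
          (ψ.contDiff.of_le (by exact_mod_cast le_top)).contDiffAt
        have a1 : ContDiffAt ℝ j (⇑(reflShift (x + h) φ) - ⇑(reflShift x φ)) y := (cd _).sub (cd _)
        have a2 : ContDiffAt ℝ j ((h : ℂ) • ⇑(reflShift x (testD φ))) y :=
          cd ((h : ℂ) • reflShift x (testD φ))
        rw [e1, iteratedDeriv_sub a1 a2,
          iteratedDeriv_sub (cd _) (cd _), iteratedDeriv_const_smul_field,
          iteratedDeriv_coe_reflShift, iteratedDeriv_coe_reflShift, iteratedDeriv_coe_reflShift,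
          ← Function.iterate_succ_apply, Function.iterate_succ_apply', smul_eq_mul,
          show x + h - y = x - y + h by ring]
        ring
      rw [e, norm_mul, norm_pow, norm_neg, norm_one, one_pow, one_mul]
      refine Test.taylor _ (fun z => ?_) _ _
      rw [← Function.iterate_succ_apply' testD, ← Function.iterate_succ_apply' testD]
      exact hM _ (by omega) z
  refine hO.trans_isLittleO ?_
  simpa using Asymptotics.isLittleO_pow_id (𝕜 := ℝ) (one_lt_two)

theorem Distr.iteratedDeriv_reflShift (T : Distr) (φ : Test) (j : ℕ) :
    iteratedDeriv j (fun x => T (reflShift x φ)) = fun x => T (reflShift x (testD^[j] φ)) := by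
  induction j with
  | zero => simp
  | succ j ih =>
    rw [iteratedDeriv_succ, ih, Function.iterate_succ_apply']
    exact funext fun x => (T.hasDerivAt_reflShift _ x).deriv

theorem Distr.contDiff_reflShift (T : Distr) (φ : Test) :
    ContDiff ℝ ∞ fun x => T (reflShift x φ) := by
  refine contDiff_of_differentiable_iteratedDeriv (n := ⊤) fun m _ => ?_
  rw [T.iteratedDeriv_reflShift]
  exact fun x => (T.hasDerivAt_reflShift _ x).differentiableAt

/-- The regularization `T ⋆ φ ∈ 𝓔(ℝ)` of a distribution, `(T ⋆ φ)(x) = ⟨T, φ(x - ·)⟩`. -/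
def Distr.reg (T : Distr) (φ : Test) : Smooth :=
  ⟨fun x => T (reflShift x φ), T.contDiff_reflShift φ⟩

theorem Distr.reg_apply (T : Distr) (φ : Test) (x : ℝ) :
    (T.reg φ : ℝ → ℂ) x = T (reflShift x φ) := rfl

theorem Distr.iteratedDeriv_reg (T : Distr) (φ : Test) (j : ℕ) :
    iteratedDeriv j (T.reg φ : ℝ → ℂ) = (T.reg (testD^[j] φ) : ℝ → ℂ) :=
  T.iteratedDeriv_reflShift φ j

/-- A linear form on test functions with the usual finite-order estimates is a distribution. -/
def Distr.ofBound (f : Test →ₗ[ℂ] ℂ)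
    (h : ∀ R : ℝ, ∃ (C : ℝ) (N : ℕ), 0 ≤ C ∧ ∀ φ : Test, (∀ x, R < |x| → φ x = 0) →
      ∀ B : ℝ, 0 ≤ B → (∀ j ≤ N, ∀ x, ‖iteratedDeriv j φ x‖ ≤ B) → ‖f φ‖ ≤ C * B) : Distr where
  toLinearMap := f
  cont := by
    refine (TestFunction.continuous_iff_continuous_comp f).2 fun K hK => ?_
    obtain ⟨R, hR⟩ := K.isCompact.isBounded.exists_norm_le
    obtain ⟨C, N, hC0, hC⟩ := h R
    refine (ContDiffMapSupportedIn.withSeminorms ℂ ℝ ℂ ⊤ K).continuous_normedSpace_rng ℂ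
      (f.comp (TestFunction.ofSupportedInCLM ℂ hK).toLinearMap)
      ⟨Finset.range (N + 1), ⟨C, hC0⟩, fun ψ => ?_⟩
    refine hC (TestFunction.ofSupportedIn hK ψ) (fun x hx => ?_) _ (apply_nonneg _ _)
      fun j hj x => ?_
    · exact ψ.zero_on_compl fun hxK => absurd (hR x hxK) (not_le.2 hx)
    · rw [← norm_iteratedFDeriv_eq_norm_iteratedDeriv]
      refine (ContDiffMapSupportedIn.norm_iteratedFDeriv_apply_le_seminorm_top ℂ (f := ψ)).trans ?_
      exact Seminorm.le_finset_sup_apply (Finset.mem_range.2 (by omega : j < N + 1))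

/-- A smooth cutoff function, equal to `0` on `(-∞, -1]` and to `1` on `[-1/2, ∞)`. -/
def cutoff (x : ℝ) : ℂ := (Real.smoothTransition (2 * x + 2) : ℝ)

theorem cutoff_contDiff : ContDiff ℝ ∞ cutoff :=
  Complex.ofRealCLM.contDiff.comp
    (Real.smoothTransition.contDiff.comp ((contDiff_const.mul contDiff_id).add contDiff_const))

theorem cutoff_of_le {x : ℝ} (hx : x ≤ -1) : cutoff x = 0 := by
  rw [cutoff, Real.smoothTransition.zero_of_nonpos (by linarith), Complex.ofReal_zero]

theorem cutoff_of_ge {x : ℝ} (hx : -1 / 2 ≤ x) : cutoff x = 1 := by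
  rw [cutoff, Real.smoothTransition.one_of_one_le (by linarith), Complex.ofReal_one]

theorem cutoff_mul_bound {K : Set ℝ} (hK : IsCompact K) (N : ℕ) :
    ∃ A : ℝ, 0 ≤ A ∧ ∀ g : ℝ → ℂ, ContDiff ℝ ∞ g → ∀ B : ℝ, 0 ≤ B →
      (∀ j ≤ N, ∀ x ∈ K, ‖iteratedDeriv j g x‖ ≤ B) →
      ∀ j ≤ N, ∀ x ∈ K, ‖iteratedDeriv j (fun x => cutoff x * g x) x‖ ≤ A * B := by
  have h1 : ∀ i : ℕ, ∃ A, ∀ x ∈ K, ‖iteratedDeriv i cutoff x‖ ≤ A := fun i =>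
    hK.exists_bound_of_continuousOn
      (cutoff_contDiff.continuous_iteratedDeriv i (by exact_mod_cast le_top)).continuousOn
  choose A hA using h1
  refine ⟨∑ j ∈ Finset.range (N + 1), ∑ i ∈ Finset.range (j + 1), j.choose i * |A i|,
    by positivity, fun g hg B hB hgB j hj x hx => ?_⟩
  have e : iteratedDeriv j (fun x => cutoff x * g x) x =
      ∑ i ∈ Finset.range (j + 1), j.choose i * iteratedDeriv i cutoff x *
        iteratedDeriv (j - i) g x :=
    iteratedDeriv_mul (cutoff_contDiff.of_le (by exact_mod_cast le_top)).contDiffAt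
      (hg.of_le (by exact_mod_cast le_top)).contDiffAt
  rw [e]
  refine (norm_sum_le _ _).trans ?_
  have h2 : ∑ i ∈ Finset.range (j + 1), (j.choose i : ℝ) * |A i| ≤
      ∑ j ∈ Finset.range (N + 1), ∑ i ∈ Finset.range (j + 1), j.choose i * |A i| :=
    Finset.single_le_sum (f := fun j => ∑ i ∈ Finset.range (j + 1), (j.choose i : ℝ) * |A i|)
      (fun j _ => by positivity) (Finset.mem_range.2 (by omega))
  refine le_trans ?_ (mul_le_mul_of_nonneg_right h2 hB)
  rw [Finset.sum_mul]
  refine Finset.sum_le_sum fun i hi => ?_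
  rw [norm_mul, norm_mul, Complex.norm_natCast]
  gcongr
  · exact (hA i x hx).trans (le_abs_self _)
  · exact hgB (j - i) (by omega) x hx

/-- The estimate of a distribution on products of the cutoff function with a smooth function. -/
theorem Distr.bound_cutoff (T : Distr) {K : Set ℝ} (hK : IsCompact K) :
    ∃ (C : ℝ) (N : ℕ), 0 ≤ C ∧ ∀ (φ : Test) (g : ℝ → ℂ), ContDiff ℝ ∞ g →
      (∀ x, φ x = cutoff x * g x) → (∀ x ∉ K, φ x = 0) → ∀ B : ℝ, 0 ≤ B →
      (∀ j ≤ N, ∀ x ∈ K, ‖iteratedDeriv j g x‖ ≤ B) → ‖T φ‖ ≤ C * B := by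
  obtain ⟨C, N, hC0, hC⟩ := T.bound hK
  obtain ⟨A, hA0, hA⟩ := cutoff_mul_bound hK N
  refine ⟨C * A, N, by positivity, fun φ g hg hφ h0 B hB h => ?_⟩
  rw [mul_assoc]
  refine hC φ h0 _ (by positivity) fun j hj x hx => ?_
  rw [show ⇑φ = fun x => cutoff x * g x from funext hφ]
  exact hA g hg B hB h j hj x hx

/-- The translated test function `y ↦ φ (x + y)`. -/
def shift (x : ℝ) (φ : Test) : Test where
  toFun y := φ (x + y)
  contDiff' := φ.contDiff.comp (contDiff_const.add contDiff_id)
  hasCompactSupport' := φ.hasCompactSupport.comp_homeomorph (Homeomorph.addLeft x)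
  tsupport_subset' _ _ := trivial

@[simp] theorem shift_apply (x : ℝ) (φ : Test) (y : ℝ) : shift x φ y = φ (x + y) := rfl

theorem shift_eq (x : ℝ) (φ : Test) : shift x φ = reflShift (-x) (refl φ) := by
  ext y
  simp [add_comm]

theorem Distr.shift_eq_reg (T : Distr) (φ : Test) :
    (fun x => T (shift x φ)) = fun x => (T.reg (refl φ) : ℝ → ℂ) (-x) := by
  funext x
  rw [shift_eq]
  rfl

theorem Distr.contDiff_shift (T : Distr) (φ : Test) : ContDiff ℝ ∞ fun x => T (shift x φ) := by
  rw [T.shift_eq_reg]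
  exact (Smooth.smooth_coe _).comp contDiff_neg

/-- Distributions supported in `[0, ∞)` vanish on test functions vanishing on `[0, ∞)` and near
the origin. -/
theorem DPlus.apply_eq_zero (T : DPlus) (φ : Test) {c : ℝ} (hc : c < 0) (h : ∀ x, c < x → φ x = 0) :
    (T : Distr) φ = 0 := by
  refine T.2 φ ((closure_minimal (fun x hx => ?_) isClosed_Iic : tsupport φ ⊆ Set.Iic c).trans
    fun x hx => lt_of_le_of_lt hx hc)
  by_contra hcon
  exact hx (h x (not_le.1 hcon))

theorem DPlus.shift_eq_zero (S : DPlus) (φ : Test) {R : ℝ} (hR : ∀ x, R < x → φ x = 0) {x : ℝ}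
    (hx : R < x) : (S : Distr) (shift x φ) = 0 :=
  DPlus.apply_eq_zero S _ (c := R - x) (by linarith) fun y hy => hR _ (by linarith)

/-- The test function `x ↦ η(x) ⟨S, φ(x + ·)⟩`, with `η` the cutoff function. -/
def convTest (S : DPlus) (φ : Test) : Test where
  toFun x := cutoff x * (S : Distr) (shift x φ)
  contDiff' := cutoff_contDiff.mul ((S : Distr).contDiff_shift φ)
  hasCompactSupport' := by
    obtain ⟨R, -, hR⟩ := φ.exists_radius
    refine HasCompactSupport.intro (isCompact_Icc (a := -1) (b := R)) fun x hx => ?_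
    by_cases h1 : x ≤ -1
    · rw [cutoff_of_le h1, zero_mul]
    · have h2 : R < x := by
        by_contra h2
        exact hx ⟨(not_le.1 h1).le, not_lt.1 h2⟩
      rw [DPlus.shift_eq_zero S φ (fun y hy => hR y (lt_of_lt_of_le hy (le_abs_self y))) h2,
        mul_zero]
  tsupport_subset' _ _ := trivial

theorem convTest_apply (S : DPlus) (φ : Test) (x : ℝ) :
    convTest S φ x = cutoff x * (S : Distr) (shift x φ) := rfl

theorem convTest_eq_zero (S : DPlus) (φ : Test) {R : ℝ} (hR : ∀ x, R < x → φ x = 0) {x : ℝ}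
    (hx : x ∉ Set.Icc (-1) R) : convTest S φ x = 0 := by
  rw [convTest_apply]
  by_cases h1 : x ≤ -1
  · rw [cutoff_of_le h1, zero_mul]
  · have h2 : R < x := by
      by_contra h2
      exact hx ⟨(not_le.1 h1).le, not_lt.1 h2⟩
    rw [DPlus.shift_eq_zero S φ hR h2, mul_zero]

theorem refl_testD_bound (φ : Test) {B : ℝ} {N : ℕ}
    (h : ∀ j ≤ N, ∀ x, ‖iteratedDeriv j φ x‖ ≤ B) :
    ∀ j ≤ N, ∀ x, ‖(testD^[j] (refl φ)) x‖ ≤ B := by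
  intro j hj x
  rw [coe_testD_iterate, refl, iteratedDeriv_coe_reflShift, norm_mul, coe_testD_iterate]
  simpa using h j hj (0 - x)

/-- The derivatives of a regularization are controlled by those of the test function. -/
theorem Distr.reg_bound (T : Distr) (a b R : ℝ) (m : ℕ) :
    ∃ (C : ℝ) (N : ℕ), 0 ≤ C ∧ m ≤ N ∧ ∀ φ : Test, (∀ x, R < |x| → φ x = 0) → ∀ B : ℝ, 0 ≤ B →
      (∀ j ≤ N, ∀ x, ‖(testD^[j] φ) x‖ ≤ B) →
      ∀ j ≤ m, ∀ x ∈ Set.Icc a b, ‖iteratedDeriv j (T.reg φ : ℝ → ℂ) x‖ ≤ C * B := by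
  obtain ⟨C, N, hC0, hC⟩ := T.bound (isCompact_Icc (a := a - R) (b := b + R))
  refine ⟨C, N + m, hC0, by omega, fun φ hφ B hB h j hj x hx => ?_⟩
  rw [T.iteratedDeriv_reg, T.reg_apply]
  refine hC _ (fun y hy => ?_) B hB fun i hi y _ => ?_
  · rw [reflShift_apply]
    refine φ.zero_of_testD hφ j _ ?_
    by_contra hcon
    have := abs_le.1 (not_lt.1 hcon)
    exact hy ⟨by linarith [hx.1], by linarith [hx.2]⟩
  · rw [iteratedDeriv_coe_reflShift, norm_mul, norm_pow, norm_neg, norm_one, one_pow, one_mul,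
      ← Function.iterate_add_apply]
    exact h _ (by omega) _

/-- The convolution product of two distributions supported in `[0, ∞)`,
`⟨T ⋆ S, φ⟩ = ⟨T(x), η(x) ⟨S(y), φ(x + y)⟩⟩`. The cutoff function `η` equals `1` near the support
of `T`, so that it does not influence the value; it is there because `x ↦ ⟨S(y), φ(x + y)⟩` need
not vanish for large negative `x`. -/
def convDistr (T S : DPlus) : Distr :=
  Distr.ofBound
    { toFun := fun φ => (T : Distr) (convTest S φ)
      map_add' := fun φ ψ => by
        rw [← map_add]
        congr 1
        ext x
        have : shift x (φ + ψ) = shift x φ + shift x ψ := by ext; simp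
        simp [convTest_apply, this, mul_add]
      map_smul' := fun c φ => by
        rw [RingHom.id_apply, ← map_smul]
        congr 1
        ext x
        have : shift x (c • φ) = c • shift x φ := by ext; simp
        simp [convTest_apply, this, mul_left_comm] }
    (fun R => by
      obtain ⟨C, N, hC0, hC⟩ := (T : Distr).bound_cutoff (isCompact_Icc (a := -1) (b := R))
      obtain ⟨C', N', hC'0, -, hC'⟩ := (S : Distr).reg_bound (-R) 1 R N
      refine ⟨C * C', N', by positivity, fun φ hφ B hB h => ?_⟩
      rw [mul_assoc]
      refine hC (convTest S φ) _ ((S : Distr).contDiff_shift φ) (fun x => rfl)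
        (fun x hx => convTest_eq_zero S φ
          (fun y hy => hφ y (lt_of_lt_of_le hy (le_abs_self y))) hx) _ (by positivity)
        fun j hj x hx => ?_
      rw [(S : Distr).shift_eq_reg, iteratedDeriv_comp_neg, norm_smul, norm_pow, norm_neg,
        norm_one, one_pow, one_mul]
      exact hC' (refl φ) (fun y hy => by rw [refl_apply]; exact hφ _ (by rwa [abs_neg])) B hB
        (refl_testD_bound φ h) j hj (-x) ⟨by linarith [hx.2], by linarith [hx.1]⟩)

theorem convDistr_apply (T S : DPlus) (φ : Test) :
    convDistr T S φ = (T : Distr) (convTest S φ) := rfl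

/-- The convolution product `⋆ : 𝓓'₊(ℝ) × 𝓓'₊(ℝ) → 𝓓'₊(ℝ)`. -/
def conv (T S : DPlus) : DPlus :=
  ⟨convDistr T S, fun φ hφ => by
    rw [convDistr_apply]
    have hc : IsCompact (tsupport φ) := φ.hasCompactSupport
    obtain ⟨c, hc0, hc⟩ : ∃ c : ℝ, c < 0 ∧ ∀ x, c < x → φ x = 0 := by
      rcases (tsupport φ).eq_empty_or_nonempty with he | hne
      · exact ⟨-1, by norm_num, fun x _ => image_eq_zero_of_notMem_tsupport (by simp [he])⟩
      · obtain ⟨c, hc1, hc2⟩ := hc.exists_isGreatest hne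
        exact ⟨c, hφ hc1, fun x hx => image_eq_zero_of_notMem_tsupport
          fun hx' => absurd (hc2 hx') (not_le.2 hx)⟩
    refine DPlus.apply_eq_zero T _ hc0 fun x hx => ?_
    rw [convTest_apply, DPlus.shift_eq_zero S φ hc hx, mul_zero]⟩

/-- The radius of support of a test function, with the value `1` at the zero function. -/
def radius (φ : Test) : ℝ :=
  open scoped Classical in if φ = 0 then 1 else sSup ((fun x : ℝ => |x|) '' {x | φ x ≠ 0})

/-- The directing sequence `𝓓₀ ⊇ 𝓓₁ ⊇ 𝓓₂ ⊇ ⋯` of sets of test functions: `𝓓₀ = 𝓓(ℝ)`, and for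
`n ≥ 1` the set `𝓓ₙ` consists of the real-valued even `φ` with radius of support `R_φ ≤ 1 / n`,
integral `1`, vanishing moments of orders `1, …, n`, `∫ |φ| ≤ 1 + 1 / n`, and
`sup |φ⁽ʲ⁾| ≤ R_φ ^ (-2 (j + 1))` for `j ≤ n`. -/
def directing (n : ℕ) : Set Test :=
  {φ | n = 0 ∨
    ((∀ x, (φ x).im = 0) ∧
      (∀ x, φ (-x) = φ x) ∧
      radius φ ≤ 1 / (n : ℝ) ∧
      ∫ x, φ x = 1 ∧
      (∀ j : ℕ, 1 ≤ j → j ≤ n → ∫ x : ℝ, (x : ℂ) ^ j * φ x = 0) ∧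
      ∫ x, ‖φ x‖ ≤ 1 + 1 / (n : ℝ) ∧
      ∀ j : ℕ, j ≤ n → ∀ x, ‖iteratedDeriv j φ x‖ ≤ (radius φ ^ (2 * (j + 1)))⁻¹)}

/-- An ultrafilter on the set of test functions containing every set of the directing sequence.
"Almost every `φ`" refers to this ultrafilter. -/
structure TestUltrafilter where
  toUltrafilter : Ultrafilter Test
  directing_mem : ∀ n, directing n ∈ toUltrafilter

theorem abs_le_radius (φ : Test) {x : ℝ} (hx : φ x ≠ 0) : |x| ≤ radius φ := by
  have h0 : φ ≠ 0 := by rintro rfl; exact hx rfl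
  obtain ⟨R, -, hR⟩ := φ.exists_radius
  rw [radius, if_neg h0]
  refine le_csSup ⟨R, ?_⟩ ⟨x, hx, rfl⟩
  rintro _ ⟨y, hy, rfl⟩
  by_contra hcon
  exact hy (hR y (not_le.1 hcon))

theorem radius_pos (φ : Test) (h : ∫ x, φ x = 1) : 0 < radius φ := by
  by_contra hcon
  have h0 : ∀ x, x ≠ 0 → φ x = 0 := by
    intro x hx
    by_contra h1
    exact absurd ((abs_pos.2 hx).trans_le (abs_le_radius φ h1)) hcon
  have h1 : (fun x => φ x) =ᵐ[MeasureTheory.volume] 0 := by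
    filter_upwards [MeasureTheory.Measure.ae_ne MeasureTheory.volume (0 : ℝ)] with x hx
    exact h0 x hx
  rw [MeasureTheory.integral_eq_zero_of_ae h1] at h
  exact zero_ne_one h

section Algebra

variable (U : TestUltrafilter)

theorem TestUltrafilter.eventually_radius (n : ℕ) :
    ∀ᶠ φ in (U.toUltrafilter : Filter Test), 0 < radius φ ∧ radius φ ≤ 1 / ((n : ℝ) + 1) := by
  filter_upwards [U.directing_mem (n + 1)] with φ hφ
  rcases hφ with h | ⟨-, -, h1, h2, -⟩
  · omega
  · exact ⟨radius_pos φ h2, by simpa using h1⟩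

theorem TestUltrafilter.eventually_half :
    ∀ᶠ φ in (U.toUltrafilter : Filter Test), 0 < radius φ ∧ radius φ ≤ 1 / 2 := by
  filter_upwards [U.eventually_radius 1] with φ hφ
  exact ⟨hφ.1, by norm_num at hφ ⊢; exact hφ.2⟩

/-- A real net is moderate if it is at most `R_φ ^ (-m)` for almost every `φ`, for some `m`. -/
def IsModerate (b : Test → ℝ) : Prop :=
  ∃ m : ℕ, ∀ᶠ φ in (U.toUltrafilter : Filter Test), b φ ≤ (radius φ ^ m)⁻¹

/-- A real net is negligible if, for every `p`, it is at most `R_φ ^ p` for almost every `φ`. -/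
def IsNegligible (b : Test → ℝ) : Prop :=
  ∀ p : ℕ, ∀ᶠ φ in (U.toUltrafilter : Filter Test), b φ ≤ radius φ ^ p

variable {U}

theorem IsModerate.mono {b c : Test → ℝ} (hc : IsModerate U c) (h : ∀ φ, b φ ≤ c φ) :
    IsModerate U b := by
  obtain ⟨m, hm⟩ := hc
  exact ⟨m, hm.mono fun φ hφ => (h φ).trans hφ⟩

theorem IsNegligible.mono {b c : Test → ℝ} (hc : IsNegligible U c) (h : ∀ φ, b φ ≤ c φ) :
    IsNegligible U b := fun p => (hc p).mono fun φ hφ => (h φ).trans hφ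

theorem IsModerate.const (c : ℝ) : IsModerate U fun _ => c := by
  obtain ⟨n, hn⟩ := exists_nat_ge c
  refine ⟨1, (U.eventually_radius n).mono fun φ hφ => ?_⟩
  rw [pow_one]
  have h1 : (0 : ℝ) < n + 1 := by positivity
  have h2 := (le_inv_comm₀ hφ.1 h1).1 (by simpa using hφ.2)
  linarith

theorem IsModerate.add {b c : Test → ℝ} (hb : IsModerate U b) (hc : IsModerate U c) :
    IsModerate U fun φ => b φ + c φ := by
  obtain ⟨m, hm⟩ := hb
  obtain ⟨n, hn⟩ := hc
  refine ⟨m + n + 1, ?_⟩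
  filter_upwards [hm, hn, U.eventually_half] with φ h1 h2 ⟨h3, h4⟩
  have h5 : ∀ i, i ≤ m + n → (radius φ ^ i)⁻¹ ≤ (radius φ ^ (m + n))⁻¹ := fun i hi =>
    inv_anti₀ (by positivity) (pow_le_pow_of_le_one h3.le (by linarith) hi)
  have h6 : 2 * (radius φ ^ (m + n))⁻¹ ≤ (radius φ ^ (m + n + 1))⁻¹ := by
    rw [pow_succ, mul_inv, mul_comm]
    refine mul_le_mul_of_nonneg_left ?_ (by positivity)
    exact (le_inv_comm₀ h3 two_pos).1 (by linarith)
  linarith [h5 m (by omega), h5 n (by omega)]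

theorem IsModerate.mul {b c : Test → ℝ} (hb0 : ∀ φ, 0 ≤ b φ) (hc0 : ∀ φ, 0 ≤ c φ)
    (hb : IsModerate U b) (hc : IsModerate U c) : IsModerate U fun φ => b φ * c φ := by
  obtain ⟨m, hm⟩ := hb
  obtain ⟨n, hn⟩ := hc
  refine ⟨m + n, ?_⟩
  filter_upwards [hm, hn] with φ h1 h2
  rw [pow_add, mul_inv]
  exact mul_le_mul h1 h2 (hc0 φ) ((hb0 φ).trans h1)

theorem IsNegligible.add {b c : Test → ℝ} (hb : IsNegligible U b) (hc : IsNegligible U c) :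
    IsNegligible U fun φ => b φ + c φ := by
  intro p
  filter_upwards [hb (p + 1), hc (p + 1), U.eventually_half] with φ h1 h2 ⟨h3, h4⟩
  have : radius φ ^ (p + 1) ≤ radius φ ^ p * (1 / 2) := by
    rw [pow_succ]
    exact mul_le_mul_of_nonneg_left h4 (by positivity)
  linarith

theorem IsNegligible.mul {b c : Test → ℝ} (hb0 : ∀ φ, 0 ≤ b φ) (hc0 : ∀ φ, 0 ≤ c φ)
    (hb : IsModerate U b) (hc : IsNegligible U c) : IsNegligible U fun φ => b φ * c φ := by
  obtain ⟨m, hm⟩ := hb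
  intro p
  filter_upwards [hm, hc (p + m), U.eventually_half] with φ h1 h2 ⟨h3, h4⟩
  refine (mul_le_mul h1 h2 (hc0 φ) ((hb0 φ).trans h1)).trans (le_of_eq ?_)
  rw [pow_add]
  field_simp

theorem IsNegligible.zero : IsNegligible U fun _ => 0 := fun p => by
  filter_upwards [U.eventually_half] with φ h
  exact pow_nonneg h.1.le p

theorem IsModerate.sum {ι : Type*} (s : Finset ι) {b : ι → Test → ℝ}
    (h : ∀ i ∈ s, IsModerate U (b i)) : IsModerate U fun φ => ∑ i ∈ s, b i φ := by
  classical
  induction s using Finset.induction_on with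
  | empty => simpa using IsModerate.const (U := U) 0
  | insert i s hi ih =>
    simp only [Finset.sum_insert hi]
    exact (h i (Finset.mem_insert_self i s)).add
      (ih fun j hj => h j (Finset.mem_insert_of_mem hj))

theorem IsNegligible.sum {ι : Type*} (s : Finset ι) {b : ι → Test → ℝ}
    (h : ∀ i ∈ s, IsNegligible U (b i)) : IsNegligible U fun φ => ∑ i ∈ s, b i φ := by
  classical
  induction s using Finset.induction_on with
  | empty => simpa using IsNegligible.zero (U := U)
  | insert i s hi ih =>
    simp only [Finset.sum_insert hi]
    exact (h i (Finset.mem_insert_self i s)).add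
      (ih fun j hj => h j (Finset.mem_insert_of_mem hj))

variable (U)

/-- The algebra of moderate nets of complex numbers. -/
def moderateC : Subalgebra ℂ (Test → ℂ) where
  carrier := {A | IsModerate U fun φ => ‖A φ‖}
  mul_mem' {A B} (hA : IsModerate U fun φ => ‖A φ‖) (hB : IsModerate U fun φ => ‖B φ‖) :=
    (hA.mul (fun _ => norm_nonneg _) (fun _ => norm_nonneg _) hB).mono fun φ =>
      norm_mul_le (A φ) (B φ)
  add_mem' {A B} (hA : IsModerate U fun φ => ‖A φ‖) (hB : IsModerate U fun φ => ‖B φ‖) :=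
    (hA.add hB).mono fun φ => norm_add_le (A φ) (B φ)
  algebraMap_mem' c := IsModerate.const ‖c‖

/-- The ideal of negligible nets of complex numbers. -/
def negligibleC : Ideal (moderateC U) where
  carrier := {A | IsNegligible U fun φ => ‖(A : Test → ℂ) φ‖}
  add_mem' {A B} (hA : IsNegligible U _) (hB : IsNegligible U _) :=
    (hA.add hB).mono fun φ => norm_add_le ((A : Test → ℂ) φ) ((B : Test → ℂ) φ)
  zero_mem' := (IsNegligible.zero (U := U)).mono fun φ => by simp
  smul_mem' C A (hA : IsNegligible U _) :=
    (IsNegligible.mul (fun _ => norm_nonneg _) (fun _ => norm_nonneg _) C.2 hA).mono fun φ =>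
      norm_mul_le ((C : Test → ℂ) φ) ((A : Test → ℂ) φ)

theorem quotientC_nontrivial : Nontrivial (moderateC U ⧸ negligibleC U) := by
  refine Ideal.Quotient.nontrivial_iff.2 fun h => ?_
  have h1 : IsNegligible U fun φ => ‖((1 : moderateC U) : Test → ℂ) φ‖ :=
    (Ideal.eq_top_iff_one _).1 h
  obtain ⟨φ, h2, h3, h4⟩ := ((h1 1).and U.eventually_half).exists
  have h5 : ‖((1 : moderateC U) : Test → ℂ) φ‖ = 1 := by simp
  have h6 : ‖((1 : moderateC U) : Test → ℂ) φ‖ ≤ radius φ ^ 1 := h2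
  rw [h5, pow_one] at h6
  linarith

theorem quotientC_isUnit_or_eq_zero (a : moderateC U ⧸ negligibleC U) : IsUnit a ∨ a = 0 := by
  obtain ⟨A, rfl⟩ := Ideal.Quotient.mk_surjective a
  by_cases hA : IsNegligible U fun φ => ‖(A : Test → ℂ) φ‖
  · exact Or.inr (Ideal.Quotient.eq_zero_iff_mem.2 hA)
  · left
    obtain ⟨p, hp⟩ := not_forall.1 hA
    have hp' := Ultrafilter.eventually_not.2 hp
    let B : moderateC U := ⟨fun φ => ((A : Test → ℂ) φ)⁻¹, p, by
      filter_upwards [hp', U.eventually_half] with φ h1 h2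
      rw [norm_inv]
      exact inv_anti₀ (pow_pos h2.1 p) (not_le.1 h1).le⟩
    have hAB : A * B - 1 ∈ negligibleC U := by
      intro q
      filter_upwards [hp', U.eventually_half] with φ h1 h2
      have h3 : (A : Test → ℂ) φ ≠ 0 := by
        intro h3
        rw [h3, norm_zero] at h1
        exact h1 (pow_nonneg h2.1.le p)
      have h4 : ((A * B - 1 : moderateC U) : Test → ℂ) φ = 0 := by
        simp [B, mul_inv_cancel₀ h3]
      rw [h4, norm_zero]
      exact pow_nonneg h2.1.le q
    have h5 : Ideal.Quotient.mk (negligibleC U) (A * B) = Ideal.Quotient.mk (negligibleC U) 1 :=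
      Ideal.Quotient.eq.2 hAB
    have h6 : Ideal.Quotient.mk (negligibleC U) (B * A) = Ideal.Quotient.mk (negligibleC U) 1 := by
      rw [mul_comm B A, h5]
    exact ⟨⟨Ideal.Quotient.mk _ A, Ideal.Quotient.mk _ B, h5, h6⟩, rfl⟩

/-- The generalized complex numbers `Ĉ`: moderate nets modulo negligible nets. -/
def Chat : Type := moderateC U ⧸ negligibleC U

/-- The generalized complex numbers form a field. -/
instance : Field (Chat U) :=
  haveI := quotientC_nontrivial U
  show Field (moderateC U ⧸ negligibleC U) from
    Field.ofIsUnitOrEqZero (quotientC_isUnit_or_eq_zero U)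

/-- The class in `Ĉ` of a moderate net. -/
def Chat.mk : moderateC U →+* Chat U := Ideal.Quotient.mk (negligibleC U)

theorem Chat.mk_surjective : Function.Surjective (Chat.mk U) := Ideal.Quotient.mk_surjective

theorem Chat.mk_eq_zero (A : moderateC U) :
    Chat.mk U A = 0 ↔ IsNegligible U fun φ => ‖(A : Test → ℂ) φ‖ :=
  Ideal.Quotient.eq_zero_iff_mem

/-- The supremum `sup_{x ∈ K} |f⁽ʲ⁾(x)|`. -/
def supOn (K : Set ℝ) (j : ℕ) (f : Smooth) : ℝ :=
  sSup ((fun x => ‖iteratedDeriv j (f : ℝ → ℂ) x‖) '' K)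

theorem supOn_nonneg (K : Set ℝ) (j : ℕ) (f : Smooth) : 0 ≤ supOn K j f :=
  Real.sSup_nonneg (by rintro _ ⟨x, -, rfl⟩; exact norm_nonneg _)

theorem supOn_le {K : Set ℝ} {j : ℕ} {f : Smooth} {B : ℝ} (hB : 0 ≤ B)
    (h : ∀ x ∈ K, ‖iteratedDeriv j (f : ℝ → ℂ) x‖ ≤ B) : supOn K j f ≤ B :=
  Real.sSup_le (by rintro _ ⟨x, hx, rfl⟩; exact h x hx) hB

theorem le_supOn {K : Set ℝ} (hK : IsCompact K) (j : ℕ) (f : Smooth) {x : ℝ} (hx : x ∈ K) :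
    ‖iteratedDeriv j (f : ℝ → ℂ) x‖ ≤ supOn K j f :=
  le_csSup (hK.bddAbove_image ((Smooth.smooth_coe f).continuous_iteratedDeriv j
    (by exact_mod_cast le_top)).norm.continuousOn) ⟨x, hx, rfl⟩

theorem Smooth.contDiffAt (f : Smooth) (j : ℕ) (x : ℝ) : ContDiffAt ℝ j (f : ℝ → ℂ) x :=
  ((Smooth.smooth_coe f).of_le (by exact_mod_cast le_top)).contDiffAt

theorem supOn_add {K : Set ℝ} (hK : IsCompact K) (j : ℕ) (f g : Smooth) :
    supOn K j (f + g) ≤ supOn K j f + supOn K j g := by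
  refine supOn_le (add_nonneg (supOn_nonneg _ _ _) (supOn_nonneg _ _ _)) fun x hx => ?_
  have : iteratedDeriv j ((f + g : Smooth) : ℝ → ℂ) x =
      iteratedDeriv j (f : ℝ → ℂ) x + iteratedDeriv j (g : ℝ → ℂ) x :=
    iteratedDeriv_add (Smooth.contDiffAt f j x) (Smooth.contDiffAt g j x)
  rw [this]
  exact (norm_add_le _ _).trans (add_le_add (le_supOn hK j f hx) (le_supOn hK j g hx))

theorem supOn_mul {K : Set ℝ} (hK : IsCompact K) (j : ℕ) (f g : Smooth) :
    supOn K j (f * g) ≤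
      ∑ i ∈ Finset.range (j + 1), (j.choose i : ℝ) * (supOn K i f * supOn K (j - i) g) := by
  have hn : ∀ i, 0 ≤ (j.choose i : ℝ) * (supOn K i f * supOn K (j - i) g) := fun i =>
    mul_nonneg (Nat.cast_nonneg _) (mul_nonneg (supOn_nonneg _ _ _) (supOn_nonneg _ _ _))
  refine supOn_le (Finset.sum_nonneg fun i _ => hn i) fun x hx => ?_
  have : iteratedDeriv j ((f * g : Smooth) : ℝ → ℂ) x = ∑ i ∈ Finset.range (j + 1),
      j.choose i * iteratedDeriv i (f : ℝ → ℂ) x * iteratedDeriv (j - i) (g : ℝ → ℂ) x :=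
    iteratedDeriv_mul (Smooth.contDiffAt f j x) (Smooth.contDiffAt g j x)
  rw [this]
  refine (norm_sum_le _ _).trans (Finset.sum_le_sum fun i _ => ?_)
  rw [norm_mul, norm_mul, Complex.norm_natCast, mul_assoc]
  refine mul_le_mul_of_nonneg_left ?_ (Nat.cast_nonneg _)
  exact mul_le_mul (le_supOn hK i f hx) (le_supOn hK _ g hx) (norm_nonneg _) (supOn_nonneg _ _ _)

theorem supOn_zero (K : Set ℝ) (j : ℕ) : supOn K j 0 = 0 := by
  refine le_antisymm (supOn_le le_rfl fun x _ => ?_) (supOn_nonneg _ _ _)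
  have : ((0 : Smooth) : ℝ → ℂ) = 0 := rfl
  rw [this, iteratedDeriv_const_zero, norm_zero]

theorem supOn_algebraMap (K : Set ℝ) (j : ℕ) (c : ℂ) : supOn K j (algebraMap ℂ Smooth c) ≤ ‖c‖ := by
  refine supOn_le (norm_nonneg _) fun x _ => ?_
  have : ((algebraMap ℂ Smooth c : Smooth) : ℝ → ℂ) = fun _ => c := rfl
  rw [this, iteratedDeriv_const]
  split_ifs <;> simp

theorem supOn_D (K : Set ℝ) (j : ℕ) (f : Smooth) : supOn K j (Smooth.D f) = supOn K (j + 1) f := by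
  have : iteratedDeriv j (Smooth.D f : ℝ → ℂ) = iteratedDeriv (j + 1) (f : ℝ → ℂ) :=
    iteratedDeriv_succ'.symm
  simp only [supOn, this]

/-- The algebra of moderate nets of smooth functions. -/
def moderateE : Subalgebra ℂ (Test → Smooth) where
  carrier := {f | ∀ K : Set ℝ, IsCompact K → ∀ j : ℕ, IsModerate U fun φ => supOn K j (f φ)}
  mul_mem' {f g} hf hg K hK j :=
    (IsModerate.sum (Finset.range (j + 1)) fun i _ =>
      (IsModerate.const (j.choose i : ℝ)).mul (fun _ => Nat.cast_nonneg _)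
        (fun φ => mul_nonneg (supOn_nonneg K i (f φ)) (supOn_nonneg K (j - i) (g φ)))
        ((hf K hK i).mul (fun _ => supOn_nonneg _ _ _) (fun _ => supOn_nonneg _ _ _)
          (hg K hK (j - i)))).mono fun φ => supOn_mul hK j (f φ) (g φ)
  add_mem' {f g} hf hg K hK j :=
    ((hf K hK j).add (hg K hK j)).mono fun φ => supOn_add hK j (f φ) (g φ)
  algebraMap_mem' c K _ j := (IsModerate.const ‖c‖).mono fun _ => supOn_algebraMap K j c

/-- The ideal of negligible nets of smooth functions. -/
def negligibleE : Ideal (moderateE U) where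
  carrier := {f | ∀ K : Set ℝ, IsCompact K → ∀ j : ℕ,
    IsNegligible U fun φ => supOn K j ((f : Test → Smooth) φ)}
  add_mem' {f g} hf hg K hK j :=
    ((hf K hK j).add (hg K hK j)).mono fun φ =>
      supOn_add hK j ((f : Test → Smooth) φ) ((g : Test → Smooth) φ)
  zero_mem' K _ j := (IsNegligible.zero (U := U)).mono fun _ => (supOn_zero K j).le
  smul_mem' g f hf K hK j :=
    (IsNegligible.sum (Finset.range (j + 1)) fun i _ =>
      IsNegligible.mul (U := U) (fun _ => Nat.cast_nonneg _)
        (fun φ => mul_nonneg (supOn_nonneg K i ((g : Test → Smooth) φ))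
          (supOn_nonneg K (j - i) ((f : Test → Smooth) φ)))
        (IsModerate.const (j.choose i : ℝ))
        (IsNegligible.mul (fun _ => supOn_nonneg _ _ _) (fun _ => supOn_nonneg _ _ _)
          (g.2 K hK i) (hf K hK (j - i)))).mono fun φ =>
      supOn_mul hK j ((g : Test → Smooth) φ) ((f : Test → Smooth) φ)

/-- The algebra `Ê(ℝ)` of generalized functions: moderate nets of smooth functions modulo
negligible nets. -/
def Ehat : Type := moderateE U ⧸ negligibleE U

instance : CommRing (Ehat U) := inferInstanceAs (CommRing (moderateE U ⧸ negligibleE U))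

instance : Algebra ℂ (Ehat U) := inferInstanceAs (Algebra ℂ (moderateE U ⧸ negligibleE U))

/-- The class in `Ê(ℝ)` of a moderate net. -/
def Ehat.mk : moderateE U →ₐ[ℂ] Ehat U := Ideal.Quotient.mkₐ ℂ (negligibleE U)

theorem Ehat.mk_surjective : Function.Surjective (Ehat.mk U) := Ideal.Quotient.mk_surjective

theorem Ehat.mk_eq_zero (f : moderateE U) :
    Ehat.mk U f = 0 ↔ ∀ K : Set ℝ, IsCompact K → ∀ j : ℕ,
      IsNegligible U fun φ => supOn K j ((f : Test → Smooth) φ) :=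
  Ideal.Quotient.eq_zero_iff_mem

/-- The constant nets of functions attached to the moderate nets of numbers. -/
def constNet : moderateC U →+* moderateE U where
  toFun A := ⟨fun φ => algebraMap ℂ Smooth ((A : Test → ℂ) φ), fun K _ j =>
    IsModerate.mono A.2 fun _ => supOn_algebraMap K j _⟩
  map_one' := Subtype.ext <| funext fun _ => map_one _
  map_mul' _ _ := Subtype.ext <| funext fun _ => map_mul _ _ _
  map_zero' := Subtype.ext <| funext fun _ => map_zero _
  map_add' _ _ := Subtype.ext <| funext fun _ => map_add _ _ _

/-- The inclusion of the generalized numbers into the generalized functions, as constants. -/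
def Chat.toEhat : Chat U →+* Ehat U :=
  Ideal.Quotient.lift (negligibleC U) ((Ehat.mk U).toRingHom.comp (constNet U)) fun A hA =>
    (Ehat.mk_eq_zero U _).2 fun K _ j =>
      IsNegligible.mono (c := fun φ => ‖(A : Test → ℂ) φ‖) hA fun _ => supOn_algebraMap K j _

theorem Chat.toEhat_mk (A : moderateC U) :
    Chat.toEhat U (Chat.mk U A) = Ehat.mk U (constNet U A) := rfl

/-- `Ê(ℝ)` is an algebra over the field `Ĉ`. -/
instance : Algebra (Chat U) (Ehat U) := RingHom.toAlgebra (Chat.toEhat U)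

theorem norm_apply_le_supOn (x : ℝ) (f : Smooth) : ‖f x‖ ≤ supOn {x} 0 f := by
  have h := le_supOn (isCompact_singleton (x := x)) 0 f rfl
  rwa [iteratedDeriv_zero] at h

/-- Evaluation of nets of functions at a real point. -/
def evalNet (x : ℝ) : moderateE U →+* moderateC U where
  toFun f := ⟨fun φ => ((f : Test → Smooth) φ : ℝ → ℂ) x,
    (f.2 {x} isCompact_singleton 0).mono fun _ => norm_apply_le_supOn x _⟩
  map_one' := rfl
  map_mul' _ _ := rfl
  map_zero' := rfl
  map_add' _ _ := rfl

/-- The value `f(x) ∈ Ĉ` of a generalized function `f` at a real point `x`. -/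
def Ehat.eval (x : ℝ) : Ehat U →+* Chat U :=
  Ideal.Quotient.lift (negligibleE U) ((Chat.mk U).comp (evalNet U x)) fun f hf =>
    (Chat.mk_eq_zero U _).2 <|
      IsNegligible.mono ((Ehat.mk_eq_zero U f).1 ((Ideal.Quotient.eq_zero_iff_mem).2 hf)
        {x} isCompact_singleton 0) fun _ => norm_apply_le_supOn x _

theorem Ehat.eval_mk (x : ℝ) (f : moderateE U) :
    Ehat.eval U x (Ehat.mk U f) = Chat.mk U (evalNet U x f) := rfl

/-- Differentiation of nets of functions. -/
def derivNet : moderateE U →ₗ[ℂ] moderateE U where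
  toFun f := ⟨fun φ => Smooth.D ((f : Test → Smooth) φ), fun K hK j =>
    (f.2 K hK (j + 1)).mono fun _ => (supOn_D K j _).le⟩
  map_add' f g := Subtype.ext <| funext fun φ =>
    Smooth.D.map_add ((f : Test → Smooth) φ) ((g : Test → Smooth) φ)
  map_smul' c f := Subtype.ext <| funext fun φ =>
    Smooth.D.map_smul c ((f : Test → Smooth) φ)

theorem derivNet_negligible (f : moderateE U) (hf : Ehat.mk U f = 0) :
    Ehat.mk U (derivNet U f) = 0 := by
  rw [Ehat.mk_eq_zero] at hf ⊢
  exact fun K hK j => (hf K hK (j + 1)).mono fun φ => (supOn_D K j ((f : Test → Smooth) φ)).le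

theorem derivNet_congr (f g : moderateE U) (h : Ehat.mk U f = Ehat.mk U g) :
    Ehat.mk U (derivNet U f) = Ehat.mk U (derivNet U g) := by
  rw [← sub_eq_zero, ← map_sub, ← map_sub]
  exact derivNet_negligible U _ (by rw [map_sub, h, sub_self])

/-- The derivative `d/dt` on `Ê(ℝ)`, acting on representatives. -/
def Ehat.D : Ehat U →ₗ[ℂ] Ehat U where
  toFun y := Ehat.mk U (derivNet U (Function.surjInv (Ehat.mk_surjective U) y))
  map_add' y z := by
    rw [← map_add, ← map_add]
    refine derivNet_congr U _ _ ?_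
    simp only [map_add, Function.surjInv_eq (Ehat.mk_surjective U)]
  map_smul' c y := by
    rw [RingHom.id_apply, ← map_smul, ← map_smul]
    refine derivNet_congr U _ _ ?_
    simp only [map_smul, Function.surjInv_eq (Ehat.mk_surjective U)]

theorem Ehat.D_mk (f : moderateE U) :
    Ehat.D U (Ehat.mk U f) = Ehat.mk U (derivNet U f) :=
  derivNet_congr U _ _ (Function.surjInv_eq (Ehat.mk_surjective U) _)

theorem TestUltrafilter.eventually_bound (N : ℕ) :
    ∀ᶠ φ in (U.toUltrafilter : Filter Test), (∀ x, 1 < |x| → φ x = 0) ∧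
      0 ≤ (radius φ ^ (2 * (N + 1)))⁻¹ ∧
      ∀ j ≤ N, ∀ x, ‖(testD^[j] φ) x‖ ≤ (radius φ ^ (2 * (N + 1)))⁻¹ := by
  filter_upwards [U.directing_mem (N + 1), U.eventually_half] with φ h1 ⟨h2, h3⟩
  refine ⟨fun x hx => ?_, by positivity, fun j hj x => ?_⟩
  · by_contra hcon
    linarith [abs_le_radius φ hcon]
  · rcases h1 with h1 | ⟨-, -, -, -, -, -, h1⟩
    · omega
    · rw [coe_testD_iterate]
      refine (h1 j (by omega) x).trans (inv_anti₀ (by positivity) ?_)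
      exact pow_le_pow_of_le_one h2.le (by linarith) (by omega)

/-- The net `(T ⋆ φ)` of regularizations of a distribution is moderate. -/
theorem reg_mem_moderateE (T : Distr) : T.reg ∈ moderateE U := by
  intro K hK j
  obtain ⟨R, hR⟩ := hK.isBounded.exists_norm_le
  obtain ⟨C, N, hC0, -, hC⟩ := T.reg_bound (-R) R 1 j
  have h : IsModerate U fun φ => C * (radius φ ^ (2 * (N + 1)))⁻¹ := by
    refine ((IsModerate.const C).mul (c := fun φ => |(radius φ ^ (2 * (N + 1)))⁻¹|)
      (fun _ => hC0) (fun _ => abs_nonneg _) ⟨2 * (N + 1), ?_⟩).mono fun φ => ?_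
    · filter_upwards [U.eventually_half] with φ h
      rw [abs_of_nonneg (inv_nonneg.2 (pow_nonneg h.1.le _))]
    · exact mul_le_mul_of_nonneg_left (le_abs_self _) hC0
  obtain ⟨m, hm⟩ := h
  refine ⟨m, ?_⟩
  filter_upwards [hm, U.eventually_bound N] with φ h1 ⟨h2, h3, h4⟩
  refine le_trans (supOn_le (mul_nonneg hC0 h3) fun x hx => ?_) h1
  exact hC φ h2 _ h3 h4 j le_rfl x (abs_le.1 (hR x hx))

/-- The canonical embedding `ι : 𝓓'(ℝ) → Ê(ℝ)`, `ι(T) = q(T ⋆ φ)`. -/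
def embed (T : Distr) : Ehat U := Ehat.mk U ⟨T.reg, reg_mem_moderateE U T⟩

/-- The span over `Ĉ` of the image under `ι` of a set of distributions. -/
def spanHat (S : Set Distr) : Submodule (Chat U) (Ehat U) :=
  Submodule.span (Chat U) (embed U '' S)

/-- Evaluation at a point, as a linear form on `𝓔(ℝ)`. -/
def Smooth.evalAt (x : ℝ) : Smooth →ₗ[ℂ] ℂ where
  toFun f := f x
  map_add' _ _ := rfl
  map_smul' _ _ := rfl

theorem Smooth.coe_D_pow (f : Smooth) (j : ℕ) :
    (((Smooth.D ^ j) f : Smooth) : ℝ → ℂ) = iteratedDeriv j (f : ℝ → ℂ) := by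
  induction j with
  | zero => simp
  | succ j ih =>
    rw [iteratedDeriv_succ, ← ih, pow_succ', Module.End.mul_apply]
    rfl

theorem Smooth.iteratedDeriv_eq (f : Smooth) (j : ℕ) (x : ℝ) :
    iteratedDeriv j (f : ℝ → ℂ) x = Smooth.evalAt x ((Smooth.D ^ j) f) := by
  rw [← Smooth.coe_D_pow]
  rfl

/-- The net `∑ A(S) (F(S) ⋆ φ)`, for moderate nets of numbers `A(S)` and distributions `F(S)`. -/
def netSum (s : Finset DPlus) (A : DPlus → moderateC U) (F : DPlus → Distr) : moderateE U :=
  ∑ S ∈ s, constNet U (A S) * ⟨(F S).reg, reg_mem_moderateE U (F S)⟩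

theorem netSum_apply (s : Finset DPlus) (A : DPlus → moderateC U) (F : DPlus → Distr) (φ : Test) :
    (netSum U s A F : Test → Smooth) φ = ∑ S ∈ s, ((A S : Test → ℂ) φ) • (F S).reg φ := by
  rw [netSum, AddSubmonoidClass.coe_finsetSum, Finset.sum_apply]
  refine Finset.sum_congr rfl fun S _ => ?_
  rw [Algebra.smul_def]
  rfl

theorem netSum_iteratedDeriv (s : Finset DPlus) (A : DPlus → moderateC U) (F : DPlus → Distr)
    (φ : Test) (j : ℕ) (x : ℝ) :
    iteratedDeriv j ((netSum U s A F : Test → Smooth) φ : ℝ → ℂ) x =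
      ∑ S ∈ s, (A S : Test → ℂ) φ * (F S).reg (testD^[j] φ) x := by
  rw [Smooth.iteratedDeriv_eq, netSum_apply, map_sum, map_sum]
  refine Finset.sum_congr rfl fun S _ => ?_
  rw [map_smul, map_smul, ← Smooth.iteratedDeriv_eq, Distr.iteratedDeriv_reg, smul_eq_mul]

theorem mk_netSum (s : Finset DPlus) (A : DPlus → moderateC U) (F : DPlus → Distr) :
    Ehat.mk U (netSum U s A F) = ∑ S ∈ s, Chat.mk U (A S) • embed U (F S) := by
  rw [netSum, map_sum]
  refine Finset.sum_congr rfl fun S _ => ?_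
  rw [map_mul]
  rfl

/-- The convolution product by `T` is well defined on the span of `𝓓'₊(ℝ)`. -/
theorem sum_embed_conv_eq_zero (T : DPlus) (s : Finset DPlus) (α : DPlus → Chat U)
    (h : ∑ S ∈ s, α S • embed U (S : Distr) = 0) :
    ∑ S ∈ s, α S • embed U (conv T S : Distr) = 0 := by
  choose A hA using fun S => Chat.mk_surjective U (α S)
  simp only [← hA] at h ⊢
  rw [← mk_netSum U s A (fun S => (S : Distr)), Ehat.mk_eq_zero] at h
  rw [← mk_netSum U s A (fun S => (conv T S : Distr)), Ehat.mk_eq_zero]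
  intro K hK j
  obtain ⟨M, hM⟩ := hK.isBounded.exists_norm_le
  obtain ⟨C, N, hC0, hC⟩ := (T : Distr).bound_cutoff (isCompact_Icc (a := -1) (b := M + 1))
  have h1 : IsNegligible U fun φ => C * ∑ i ∈ Finset.range (N + 1),
      supOn (Set.Icc (-(2 * M + 1)) (M + 1)) (i + j)
        ((netSum U s A (fun S => (S : Distr)) : Test → Smooth) φ) :=
    IsNegligible.mul (fun _ => hC0) (fun φ => Finset.sum_nonneg fun i _ => supOn_nonneg _ _ _)
      (IsModerate.const C) (IsNegligible.sum _ fun i _ => h _ isCompact_Icc _)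
  intro p
  filter_upwards [h1 p, U.eventually_bound 0] with φ h2 hb
  have h3 := hb.1
  refine le_trans (supOn_le (mul_nonneg hC0
    (Finset.sum_nonneg fun i _ => supOn_nonneg _ _ _)) fun x hx => ?_) h2
  have hx' := abs_le.1 (hM x hx)
  set F : Smooth := (netSum U s A (fun S => (S : Distr)) : Test → Smooth) φ with hF
  let ψ : Test := testD^[j] φ
  let θ : Test := ∑ S ∈ s, ((A S : Test → ℂ) φ) • convTest S (reflShift x ψ)
  have e1 : iteratedDeriv j ((netSum U s A (fun S => (conv T S : Distr)) : Test → Smooth) φ) x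
      = (T : Distr) θ := by
    rw [netSum_iteratedDeriv, map_sum]
    refine Finset.sum_congr rfl fun S _ => ?_
    rw [map_smul, smul_eq_mul]
    rfl
  have hθ : ∀ y, θ y = ∑ S ∈ s, (A S : Test → ℂ) φ * convTest S (reflShift x ψ) y := by
    intro y
    simp [θ]
  rw [e1]
  refine hC θ (fun y => iteratedDeriv j F (x - y)) ?_ ?_ ?_ _
    (Finset.sum_nonneg fun i _ => supOn_nonneg _ _ _) fun i hi y hy => ?_
  · refine ContDiff.comp (g := iteratedDeriv j F) ?_ (contDiff_const.sub contDiff_id)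
    rw [← Smooth.coe_D_pow]
    exact Smooth.smooth_coe _
  · intro y
    rw [hθ, hF, netSum_iteratedDeriv, Finset.mul_sum]
    refine Finset.sum_congr rfl fun S _ => ?_
    rw [convTest_apply, mul_left_comm, Distr.reg_apply]
    have : shift y (reflShift x ψ) = reflShift (x - y) ψ := by
      ext z
      simp [sub_sub]
    rw [this]
  · intro y hy
    rw [hθ]
    refine Finset.sum_eq_zero fun S _ => ?_
    rw [convTest_eq_zero S _ (R := M + 1) (fun z hz => ?_) hy, mul_zero]
    rw [reflShift_apply]
    exact φ.zero_of_testD h3 j _ (lt_of_lt_of_le (by linarith [hx'.2]) (neg_le_abs _))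
  · have e2 : iteratedDeriv i (fun y => iteratedDeriv j F (x - y)) y =
        (-1 : ℝ) ^ i • iteratedDeriv (i + j) F (x - y) := by
      rw [congrFun (iteratedDeriv_comp_const_sub i (iteratedDeriv j F) x) y,
        iteratedDeriv_eq_iterate, iteratedDeriv_eq_iterate, iteratedDeriv_eq_iterate,
        Function.iterate_add_apply]
    rw [e2, norm_smul, norm_pow, norm_neg, norm_one, one_pow, one_mul]
    refine (le_supOn (isCompact_Icc (a := -(2 * M + 1)) (b := M + 1)) (i + j) F
      ⟨by linarith [hy.2], by linarith [hy.1]⟩).trans ?_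
    exact Finset.single_le_sum (f := fun i => supOn (Set.Icc (-(2 * M + 1)) (M + 1)) (i + j) F)
      (fun i _ => supOn_nonneg _ _ _) (Finset.mem_range.2 (by omega))

theorem exists_rep (f : spanHat U (DPlus : Set Distr)) :
    ∃ l : DPlus →₀ Chat U, l.sum (fun S α => α • embed U (S : Distr)) = (f : Ehat U) := by
  have h : (f : Ehat U) ∈ Submodule.span (Chat U) (embed U '' (DPlus : Set Distr)) := f.2
  rw [Set.image_eq_range] at h
  exact (Finsupp.mem_span_range_iff_exists_finsupp).1 h

theorem embed_mem_spanHat (S : DPlus) : embed U (S : Distr) ∈ spanHat U (DPlus : Set Distr) :=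
  Submodule.subset_span ⟨S, S.2, rfl⟩

/-- The convolution product of `T ∈ 𝓓'₊(ℝ)` with an element `f = ∑ αₙ ι(Tₙ)` of the span of
`𝓓'₊(ℝ)`, given by `T ⋆ f = ∑ αₙ ι(T ⋆ Tₙ)`. -/
def starHat (T : DPlus) (f : spanHat U (DPlus : Set Distr)) : spanHat U (DPlus : Set Distr) :=
  ⟨(exists_rep U f).choose.sum fun S α => α • embed U (conv T S : Distr),
    Submodule.sum_mem _ fun S _ => Submodule.smul_mem _ _ (embed_mem_spanHat U (conv T S))⟩

/-- The convolution product does not depend on the chosen representation of `f`. -/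
theorem starHat_eq (T : DPlus) (f : spanHat U (DPlus : Set Distr)) (l : DPlus →₀ Chat U)
    (hl : l.sum (fun S α => α • embed U (S : Distr)) = (f : Ehat U)) :
    (starHat U T f : Ehat U) = l.sum fun S α => α • embed U (conv T S : Distr) := by
  set l' := (exists_rep U f).choose with hl'
  have h' : l'.sum (fun S α => α • embed U (S : Distr)) = (f : Ehat U) :=
    (exists_rep U f).choose_spec
  have h1 : (l' - l).sum (fun S α => α • embed U (S : Distr)) = 0 := by
    rw [Finsupp.sum_sub_index (fun _ _ _ => sub_smul _ _ _), h', hl, sub_self]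
  have h2 := sum_embed_conv_eq_zero U T (l' - l).support (l' - l) h1
  have h3 : (l' - l).sum (fun S α => α • embed U (conv T S : Distr)) = 0 := h2
  rw [Finsupp.sum_sub_index (fun _ _ _ => sub_smul _ _ _), sub_eq_zero] at h3
  exact h3

/-- The Wronskian `det (y_n⁽ⁱ⁾)` of a finite family of generalized functions. -/
def wronskian {k : ℕ} (y : Fin k → Ehat U) : Ehat U :=
  Matrix.det (Matrix.of fun i n : Fin k => (Ehat.D U ^ (i : ℕ)) (y n))

/-- `y` solves the initial value problem `P(d/dt) y = f`, `y(0) = y'(0) = ⋯ = y⁽ᵏ⁻¹⁾(0) = 0`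
in `Ê(ℝ)`. -/
def IsSteadyState (P : ℂ[X]) (k : ℕ) (f y : Ehat U) : Prop :=
  Polynomial.aeval (Ehat.D U) P y = f ∧ ∀ i < k, Ehat.eval U 0 ((Ehat.D U ^ i) y) = 0

/-- `G ∈ 𝓓'₊(ℝ)` is a Green function of `P(d/dt)`: `P(d/dt) G = δ`, and `G = 0` on `(-∞, 0)`. -/
def IsGreen (P : ℂ[X]) (G : DPlus) : Prop :=
  Polynomial.aeval Distr.D P (G : Distr) = Distr.dirac

/-- `y₁, …, y_k` are linearly independent solutions of `P(d/dt) y = 0` in `𝓔(ℝ)`. -/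
def IsFundamentalSystem (P : ℂ[X]) {k : ℕ} (y : Fin k → Smooth) : Prop :=
  LinearIndependent ℂ y ∧ ∀ n, Polynomial.aeval Smooth.D P (y n) = 0

end Algebra

end TodorovVernaeve

end

open TodorovVernaeve

noncomputable section

namespace TodorovVernaeve

/-! ### Linear equations with constant coefficients -/

/-! Everything reduces to the first-order operators `d/dt - a`. Over `ℂ` a polynomial of positive
degree splits off a linear factor, so induction on the degree carries both uniqueness
(`eq_zero_of_aeval_eq_zero`) and solvability (`exists_aeval_eq`) from order one to order `k`, for an
arbitrary operator on a complex vector space. On smooth functions the first-order problem is settled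
by exponentials. This gives a fundamental system with prescribed initial values, and shows that the
Wronskian of any fundamental system is nonzero at the origin. On generalized functions only
uniqueness is taken from this scheme; its core is `Ehat.eq_zero_of_D_eq_zero`, the mean value
inequality applied to representatives.

Existence comes from the explicit formula. On `𝓓'₊(ℝ)` convolution commutes with differentiation in
each factor and `δ` is a two-sided unit. Hence a Green function of a product of operators is
obtained by convolving Green functions of the factors, `P(d/dt)(G ⋆ T) = T` for every `T`, and `G`
is unique. By linearity over `Ĉ`, `G ⋆ f` solves the inhomogeneous equation in `Ê(ℝ)`.

Its initial values are then cancelled by a solution of the homogeneous equation. The coefficients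
solve a linear system whose matrix is the Wronskian matrix at the origin, so Cramer's rule gives the
`c n`. The determinant is nonzero in `Ĉ` because it is the class of a net converging along the
ultrafilter to the classical Wronskian at the origin, whereas negligible nets tend to `0`. -/

theorem exists_eq_X_sub_C_mul {P : ℂ[X]} {k : ℕ} (hP : P.degree = ((k + 1 : ℕ) : WithBot ℕ)) :
    ∃ (a : ℂ) (Q : ℂ[X]), Q.degree = (k : WithBot ℕ) ∧
      P = (Polynomial.X - Polynomial.C a) * Q := by
  obtain ⟨a, ha⟩ := Complex.exists_root (f := P) (by rw [hP]; exact_mod_cast Nat.succ_pos k)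
  obtain ⟨Q, rfl⟩ := Polynomial.dvd_iff_isRoot.2 ha
  refine ⟨a, Q, ?_, rfl⟩
  have hQ : Q ≠ 0 := by
    rintro rfl
    rw [mul_zero, Polynomial.degree_zero] at hP
    exact WithBot.bot_ne_natCast _ hP
  rw [Polynomial.degree_mul, Polynomial.degree_X_sub_C, Polynomial.degree_eq_natDegree hQ] at hP
  rw [Polynomial.degree_eq_natDegree hQ]
  norm_cast at hP ⊢
  omega

section LinearEquation

variable {M : Type*} [AddCommGroup M] [Module ℂ M]

theorem aeval_X_sub_C_mul_apply (D : Module.End ℂ M) (a : ℂ) (Q : ℂ[X]) (y : M) :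
    Polynomial.aeval D ((Polynomial.X - Polynomial.C a) * Q) y =
      D (Polynomial.aeval D Q y) - a • Polynomial.aeval D Q y := by
  simp [Module.algebraMap_end_apply]

theorem aeval_apply_eq_sum (D : Module.End ℂ M) {P : ℂ[X]} {k : ℕ}
    (hP : P.degree = (k : WithBot ℕ)) (y : M) :
    Polynomial.aeval D P y = ∑ i ∈ Finset.range (k + 1), P.coeff i • (D ^ i) y := by
  rw [Polynomial.aeval_eq_sum_range, Polynomial.natDegree_eq_of_degree_eq_some hP,
    LinearMap.sum_apply]
  rfl

theorem coeff_ne_zero_of_degree_eq {P : ℂ[X]} {k : ℕ} (hP : P.degree = (k : WithBot ℕ)) :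
    P.coeff k ≠ 0 := Polynomial.coeff_ne_zero_of_eq_degree hP

/-- Uniqueness for the initial value problem of an arbitrary order follows from uniqueness at
the first order. -/
theorem eq_zero_of_aeval_eq_zero (D : Module.End ℂ M) (V : Submodule ℂ M)
    (h : ∀ (a : ℂ) (y : M), D y = a • y → y ∈ V → y = 0) {P : ℂ[X]} {k : ℕ}
    (hP : P.degree = (k : WithBot ℕ)) {y : M} (hy : Polynomial.aeval D P y = 0)
    (h0 : ∀ i < k, (D ^ i) y ∈ V) : y = 0 := by
  induction k generalizing P with
  | zero =>
    rw [aeval_apply_eq_sum D hP] at hy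
    simpa [coeff_ne_zero_of_degree_eq hP] using hy
  | succ k ih =>
    obtain ⟨a, Q, hQ, rfl⟩ := exists_eq_X_sub_C_mul hP
    rw [aeval_X_sub_C_mul_apply, sub_eq_zero] at hy
    -- The element `Q(D) y` solves the first-order equation and lies in `V`, being a combination of
    -- the `D ^ i y` with `i ≤ k`. So it vanishes, and the induction hypothesis applies to `Q`.
    refine ih hQ (h a _ hy ?_) fun i hi => h0 i (by omega)
    rw [aeval_apply_eq_sum D hQ]
    exact V.sum_mem fun i hi => V.smul_mem _ (h0 i (Finset.mem_range.1 hi))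

/-- Solvability of the initial value problem of an arbitrary order follows from solvability at
the first order. -/
theorem exists_aeval_eq {N : Type*} [AddCommGroup N] [Module ℂ N] (D : Module.End ℂ M)
    (ev : M →ₗ[ℂ] N) (h : ∀ (a : ℂ) (f : M) (c : N), ∃ y, D y = a • y + f ∧ ev y = c)
    {P : ℂ[X]} {k : ℕ} (hP : P.degree = (k : WithBot ℕ)) (f : M) (c : ℕ → N) :
    ∃ y, Polynomial.aeval D P y = f ∧ ∀ i < k, ev ((D ^ i) y) = c i := by
  induction k generalizing P f with
  | zero =>
    refine ⟨(P.coeff 0)⁻¹ • f, ?_, by simp⟩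
    rw [aeval_apply_eq_sum D hP]
    simp [smul_smul, mul_inv_cancel₀ (coeff_ne_zero_of_degree_eq hP)]
  | succ k ih =>
    obtain ⟨a, Q, hQ, rfl⟩ := exists_eq_X_sub_C_mul hP
    -- The unknown is found through `z = Q(D) y`. Its initial value is forced: it is the one that
    -- `Q(D) y` has when each `D ^ i y` takes the value `c i`.
    obtain ⟨z, hz, hz0⟩ := h a f (∑ i ∈ Finset.range (k + 1), Q.coeff i • c i)
    obtain ⟨y, rfl, hy⟩ := ih hQ z
    refine ⟨y, by rw [aeval_X_sub_C_mul_apply, hz, add_sub_cancel_left], fun i hi => ?_⟩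
    rcases Nat.lt_succ_iff_lt_or_eq.1 hi with hi | rfl
    · exact hy i hi
    -- The top condition is not among those given by induction. It is read off from the initial
    -- value of `z`: the lower terms agree and the leading coefficient of `Q` can be cancelled.
    · rw [aeval_apply_eq_sum D hQ, map_sum, Finset.sum_range_succ, Finset.sum_range_succ] at hz0
      have h1 : ∑ j ∈ Finset.range i, ev (Q.coeff j • (D ^ j) y) =
          ∑ j ∈ Finset.range i, Q.coeff j • c j :=
        Finset.sum_congr rfl fun j hj => by rw [map_smul, hy j (Finset.mem_range.1 hj)]
      rw [h1, map_smul] at hz0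
      exact smul_right_injective N (coeff_ne_zero_of_degree_eq hQ) (add_left_cancel hz0)

end LinearEquation

/-! ### Smooth functions -/

theorem Smooth.ext {f g : Smooth} (h : ∀ x, f x = g x) : f = g := Subtype.ext (funext h)

theorem Smooth.hasDerivAt (f : Smooth) (x : ℝ) : HasDerivAt (f : ℝ → ℂ) (Smooth.D f x) x :=
  (Smooth.diff_coe f x).hasDerivAt

theorem Smooth.D_apply_of_hasDerivAt {f : Smooth} {x : ℝ} {c : ℂ} (h : HasDerivAt (f : ℝ → ℂ) c x) :
    Smooth.D f x = c := h.deriv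

theorem Smooth.D_mul (f g : Smooth) : Smooth.D (f * g) = Smooth.D f * g + f * Smooth.D g :=
  Smooth.ext fun x => Smooth.D_apply_of_hasDerivAt ((f.hasDerivAt x).mul (g.hasDerivAt x))

theorem Smooth.D_algebraMap (c : ℂ) : Smooth.D (algebraMap ℂ Smooth c) = 0 :=
  Smooth.ext fun x => Smooth.D_apply_of_hasDerivAt (hasDerivAt_const x c)

/-- The function `x ↦ exp (a x)`. -/
def Smooth.expo (a : ℂ) : Smooth :=
  ⟨fun x : ℝ => Complex.exp (a * x),
    show ContDiff ℝ ∞ fun x : ℝ => Complex.exp (a * Complex.ofRealCLM x) from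
      (contDiff_const.mul Complex.ofRealCLM.contDiff).cexp⟩

theorem Smooth.expo_apply (a : ℂ) (x : ℝ) : Smooth.expo a x = Complex.exp (a * x) := rfl

theorem Smooth.D_expo (a : ℂ) : Smooth.D (Smooth.expo a) = a • Smooth.expo a :=
  Smooth.ext fun x => by
    have h := ((Complex.ofRealCLM.hasDerivAt (x := x)).const_mul a).cexp
    refine (Smooth.D_apply_of_hasDerivAt h).trans ?_
    change _ = a * Complex.exp (a * x)
    simp [mul_comm]

theorem Smooth.expo_mul_neg (a : ℂ) : Smooth.expo a * Smooth.expo (-a) = 1 :=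
  Smooth.ext fun x => by
    change Complex.exp (a * x) * Complex.exp (-a * x) = 1
    rw [← Complex.exp_add, neg_mul, add_neg_cancel, Complex.exp_zero]

/-- The primitive of `f` vanishing at the origin. -/
def Smooth.primitive (f : Smooth) : Smooth :=
  ⟨fun x => ∫ t in (0 : ℝ)..x, f t, contDiff_infty_iff_deriv.2
    ⟨fun x => ((Smooth.smooth_coe f).continuous.integral_hasStrictDerivAt 0 x).hasDerivAt.differentiableAt, by
      rw [show deriv (fun x => ∫ t in (0 : ℝ)..x, f t) = f from
        funext fun _ => (Smooth.smooth_coe f).continuous.deriv_integral _ _ _]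
      exact Smooth.smooth_coe f⟩⟩

theorem Smooth.D_primitive (f : Smooth) : Smooth.D (Smooth.primitive f) = f :=
  Smooth.ext fun _ => (Smooth.smooth_coe f).continuous.deriv_integral _ _ _

theorem Smooth.primitive_zero (f : Smooth) : Smooth.primitive f 0 = 0 :=
  intervalIntegral.integral_same

/-- Variation of constants: `y(x) = exp(a x) (c + ∫₀ˣ exp(-a t) f(t) dt)`. -/
theorem Smooth.exists_first_order (a : ℂ) (f : Smooth) (c : ℂ) :
    ∃ y, Smooth.D y = a • y + f ∧ Smooth.evalAt 0 y = c := by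
  refine ⟨Smooth.expo a * (algebraMap ℂ Smooth c + Smooth.primitive (Smooth.expo (-a) * f)), ?_, ?_⟩
  · rw [Smooth.D_mul, map_add, Smooth.D_algebraMap, Smooth.D_primitive, Smooth.D_expo, zero_add,
      ← mul_assoc, Smooth.expo_mul_neg, one_mul, smul_mul_assoc]
  · change Smooth.expo a 0 * (c + Smooth.primitive (Smooth.expo (-a) * f) 0) = c
    rw [Smooth.primitive_zero, Smooth.expo_apply]
    simp

/-- Integrating factor: `exp(-a x) y` has zero derivative, hence is constant, equal to its value `0`
at the origin; multiplying by `exp(a x)` recovers `y`. -/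
theorem Smooth.first_order_unique (a : ℂ) (y : Smooth) (h : Smooth.D y = a • y)
    (h0 : y ∈ LinearMap.ker (Smooth.evalAt 0)) : y = 0 := by
  have h1 : Smooth.D (Smooth.expo (-a) * y) = 0 := by
    rw [Smooth.D_mul, h, Smooth.D_expo, smul_mul_assoc, mul_smul_comm, neg_smul, neg_add_cancel]
  have h2 : Smooth.expo (-a) * y = 0 := Smooth.ext fun x => by
    have h3 := is_const_of_deriv_eq_zero (Smooth.diff_coe (Smooth.expo (-a) * y))
      (fun x => congrFun (congrArg Subtype.val h1) x) x 0
    refine h3.trans ?_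
    change Smooth.expo (-a) 0 * y 0 = 0
    rw [show y 0 = 0 from h0, mul_zero]
  rw [← one_mul y, ← Smooth.expo_mul_neg a, mul_assoc, h2, mul_zero]

/-! ### Fundamental systems and the classical Wronskian -/

/-- The `n`-th solution is given the `n`-th standard basis vector as initial data. Evaluating the
`i`-th derivative of a linear relation at `0` then isolates its `i`-th coefficient. -/
theorem exists_isFundamentalSystem {P : ℂ[X]} {k : ℕ} (hP : P.degree = (k : WithBot ℕ)) :
    ∃ y : Fin k → Smooth, IsFundamentalSystem P y := by
  choose y hy hy0 using fun n : Fin k => exists_aeval_eq Smooth.D (Smooth.evalAt 0)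
    Smooth.exists_first_order hP 0 (Pi.single (n : ℕ) 1)
  refine ⟨y, Fintype.linearIndependent_iff.2 fun g hg i => ?_, hy⟩
  have h := congrArg (fun z => Smooth.evalAt 0 ((Smooth.D ^ (i : ℕ)) z)) hg
  simp only [map_sum, map_smul, map_zero, smul_eq_mul] at h
  rw [Finset.sum_eq_single i] at h
  · simpa [hy0] using h
  · intro j _ hj
    rw [hy0 j i i.2, Pi.single_eq_of_ne (by simpa [Fin.ext_iff] using hj.symm), mul_zero]
  · simp

/-- The Wronskian matrix at the origin of a family of smooth functions. -/
def Smooth.wronskianMatrix {k : ℕ} (y : Fin k → Smooth) : Matrix (Fin k) (Fin k) ℂ :=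
  Matrix.of fun i n => Smooth.evalAt 0 ((Smooth.D ^ (i : ℕ)) (y n))

/-- A kernel vector `v` of the matrix would make `∑ vₙ yₙ` a homogeneous solution with zero initial
values. By uniqueness this sum is zero, against linear independence. -/
theorem IsFundamentalSystem.det_ne_zero {P : ℂ[X]} {k : ℕ} (hP : P.degree = (k : WithBot ℕ))
    {y : Fin k → Smooth} (hy : IsFundamentalSystem P y) : (Smooth.wronskianMatrix y).det ≠ 0 := by
  intro h
  obtain ⟨v, hv, h0⟩ := Matrix.exists_mulVec_eq_zero_iff.2 h
  have h1 : ∑ n, v n • y n = 0 := by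
    refine eq_zero_of_aeval_eq_zero Smooth.D (LinearMap.ker (Smooth.evalAt 0))
      Smooth.first_order_unique hP ?_ fun i hi => ?_
    · simp only [map_sum, map_smul, hy.2, smul_zero, Finset.sum_const_zero]
    · have h2 := congrFun h0 ⟨i, hi⟩
      simp only [LinearMap.mem_ker, map_sum, map_smul, smul_eq_mul]
      simpa [Matrix.mulVec, dotProduct, Smooth.wronskianMatrix, mul_comm] using h2
  exact hv (funext (Fintype.linearIndependent_iff.1 hy.1 v h1))

/-! ### Generalized functions -/

section Algebra

variable (U : TestUltrafilter)

theorem Ehat.D_mul (y z : Ehat U) : Ehat.D U (y * z) = Ehat.D U y * z + y * Ehat.D U z := by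
  obtain ⟨f, rfl⟩ := Ehat.mk_surjective U y
  obtain ⟨g, rfl⟩ := Ehat.mk_surjective U z
  rw [← map_mul, Ehat.D_mk, Ehat.D_mk, Ehat.D_mk, ← map_mul, ← map_mul, ← map_add]
  exact congrArg _ (Subtype.ext (funext fun φ => Smooth.D_mul _ _))

theorem Ehat.D_toEhat (c : Chat U) : Ehat.D U (Chat.toEhat U c) = 0 := by
  obtain ⟨A, rfl⟩ := Chat.mk_surjective U c
  rw [Chat.toEhat_mk, Ehat.D_mk, ← map_zero (Ehat.mk U)]
  exact congrArg _ (Subtype.ext (funext fun φ => Smooth.D_algebraMap _))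

theorem Ehat.smul_eq (c : Chat U) (y : Ehat U) : c • y = Chat.toEhat U c * y := rfl

/-- `Ehat.D` is bundled as a map linear over `ℂ` only. Linearity over `Ĉ`, needed to move `P(d/dt)`
past generalized coefficients, comes from the Leibniz rule, since generalized constants have
derivative zero. -/
theorem Ehat.D_smul (c : Chat U) (y : Ehat U) : Ehat.D U (c • y) = c • Ehat.D U y := by
  rw [Ehat.smul_eq, Ehat.D_mul, Ehat.D_toEhat, zero_mul, zero_add, Ehat.smul_eq]

theorem Ehat.D_pow_smul (c : Chat U) (y : Ehat U) (i : ℕ) :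
    (Ehat.D U ^ i) (c • y) = c • (Ehat.D U ^ i) y := by
  induction i with
  | zero => rfl
  | succ i ih => rw [pow_succ', Module.End.mul_apply, ih, Ehat.D_smul, Module.End.mul_apply]

theorem Ehat.aeval_D_smul (P : ℂ[X]) (c : Chat U) (y : Ehat U) :
    Polynomial.aeval (Ehat.D U) P (c • y) = c • Polynomial.aeval (Ehat.D U) P y := by
  simp only [Polynomial.aeval_eq_sum_range, LinearMap.sum_apply, LinearMap.smul_apply,
    Ehat.D_pow_smul, Finset.smul_sum]
  refine Finset.sum_congr rfl fun i _ => ?_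
  rw [Ehat.smul_eq, Ehat.smul_eq, mul_smul_comm]

theorem Ehat.eval_toEhat (x : ℝ) (c : Chat U) : Ehat.eval U x (Chat.toEhat U c) = c := by
  obtain ⟨A, rfl⟩ := Chat.mk_surjective U c
  rfl

theorem Ehat.eval_smul (x : ℝ) (c : Chat U) (y : Ehat U) :
    Ehat.eval U x (c • y) = c * Ehat.eval U x y := by
  rw [Ehat.smul_eq, map_mul, Ehat.eval_toEhat]

/-- Mean value inequality on `[-|M|, |M|]`, an interval containing both `K` and the origin. The
absolute value covers a negative `M`, which is possible when `K` is empty. -/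
theorem supOn_zero_le_of_D {K : Set ℝ} {M : ℝ} (hM : ∀ x ∈ K, ‖x‖ ≤ M) (f : Smooth) :
    supOn K 0 f ≤ ‖f 0‖ + |M| * supOn (Set.Icc (-|M|) |M|) 0 (Smooth.D f) := by
  have h0 := supOn_nonneg (Set.Icc (-|M|) |M|) 0 (Smooth.D f)
  refine supOn_le (by positivity) fun x hx => ?_
  have hx' : |x| ≤ |M| := (hM x hx).trans (le_abs_self M)
  have h1 := (convex_Icc (-|M|) |M|).norm_image_sub_le_of_norm_hasDerivWithin_le (𝕜 := ℝ)
    (f := (f : ℝ → ℂ)) (fun t _ => (f.hasDerivAt t).hasDerivWithinAt)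
    (fun t ht => by
      have := le_supOn isCompact_Icc 0 (Smooth.D f) ht
      rwa [iteratedDeriv_zero] at this)
    (show (0 : ℝ) ∈ _ by simp) (abs_le.1 hx')
  rw [iteratedDeriv_zero]
  rw [sub_zero, Real.norm_eq_abs, mul_comm] at h1
  have h2 := mul_le_mul_of_nonneg_right hx' h0
  have h3 := norm_le_insert' (f x) (f 0)
  linarith

/-- For a representative, the derivatives of order at least one are negligible by hypothesis. Only
order zero needs an argument: there the function is controlled by its value at `0` and by its
derivative on a larger compact interval. -/
theorem Ehat.eq_zero_of_D_eq_zero {y : Ehat U} (h : Ehat.D U y = 0) (h0 : Ehat.eval U 0 y = 0) :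
    y = 0 := by
  obtain ⟨f, rfl⟩ := Ehat.mk_surjective U y
  rw [Ehat.D_mk, Ehat.mk_eq_zero] at h
  rw [Ehat.eval_mk, Chat.mk_eq_zero] at h0
  rw [Ehat.mk_eq_zero]
  rintro K hK (_ | j)
  · obtain ⟨M, hM⟩ := hK.isBounded.exists_norm_le
    exact (h0.add (IsNegligible.mul (fun _ => abs_nonneg M) (fun _ => supOn_nonneg _ _ _)
      (IsModerate.const |M|) (h _ isCompact_Icc 0))).mono fun φ => supOn_zero_le_of_D hM _
  · exact (h K hK j).mono fun φ => (supOn_D K j _).ge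

/-- A smooth function as a constant net. -/
def smoothNet : Smooth →ₐ[ℂ] moderateE U where
  toFun f := ⟨fun _ => f, fun _ _ _ => IsModerate.const _⟩
  map_one' := rfl
  map_mul' _ _ := rfl
  map_zero' := rfl
  map_add' _ _ := rfl
  commutes' _ := rfl

/-- The submodule of generalized functions vanishing at the origin. -/
def Ehat.vanishing : Submodule ℂ (Ehat U) where
  carrier := {y | Ehat.eval U 0 y = 0}
  add_mem' {y z} (hy : _ = _) (hz : _ = _) := by
    rw [Set.mem_ofPred_eq, map_add, hy, hz, add_zero]
  zero_mem' := map_zero _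
  smul_mem' c y (hy : _ = _) := by
    rw [Set.mem_ofPred_eq, Algebra.smul_def, map_mul, hy, mul_zero]

/-- The integrating factor argument carries over, with "zero derivative and zero value at the
origin" replacing the constancy of a smooth function. -/
theorem Ehat.first_order_unique (a : ℂ) (y : Ehat U) (h : Ehat.D U y = a • y)
    (h0 : y ∈ Ehat.vanishing U) : y = 0 := by
  -- The exponentials enter as constant nets, not through `ι`, so that their differential equation
  -- and `e a * e (-a) = 1` hold already on representatives.
  let e : ℂ → Ehat U := fun b => Ehat.mk U (smoothNet U (Smooth.expo b))
  have he : ∀ b, Ehat.D U (e b) = b • e b := fun b => by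
    simp only [e]
    rw [Ehat.D_mk, ← map_smul, ← map_smul, ← Smooth.D_expo]
    rfl
  have h1 : e (-a) * y = 0 := by
    refine Ehat.eq_zero_of_D_eq_zero U ?_ ?_
    · rw [Ehat.D_mul, h, he, smul_mul_assoc, mul_smul_comm, neg_smul, neg_add_cancel]
    · rw [map_mul, show Ehat.eval U 0 y = 0 from h0, mul_zero]
  have h2 : e a * e (-a) = 1 := by
    simp only [e]
    rw [← map_mul, ← map_mul, Smooth.expo_mul_neg, map_one, map_one]
  rw [← one_mul y, ← h2, mul_assoc, h1, mul_zero]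

theorem IsSteadyState.unique {P : ℂ[X]} {k : ℕ} (hP : P.degree = (k : WithBot ℕ)) {f y z : Ehat U}
    (hy : IsSteadyState U P k f y) (hz : IsSteadyState U P k f z) : y = z := by
  refine sub_eq_zero.1 (eq_zero_of_aeval_eq_zero (Ehat.D U) (Ehat.vanishing U)
    (Ehat.first_order_unique U) hP ?_ fun i hi => ?_)
  · rw [map_sub, hy.1, hz.1, sub_self]
  · rw [map_sub]
    exact Submodule.sub_mem _ (hy.2 i hi) (hz.2 i hi)

end Algebra

/-! ### Distributions and the convolution product -/

/-- A linear map intertwining two operators intertwines every polynomial in them. It serves for the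
inclusion of `𝓓'₊(ℝ)`, for convolution in either factor, for smooth functions viewed as
distributions, and for `ι`. -/
theorem aeval_apply_of_commute {M N : Type*} [AddCommGroup M] [Module ℂ M] [AddCommGroup N]
    [Module ℂ N] (L : M →ₗ[ℂ] N) (D : Module.End ℂ M) (D' : Module.End ℂ N)
    (h : ∀ x, L (D x) = D' (L x)) (P : ℂ[X]) (x : M) :
    L (Polynomial.aeval D P x) = Polynomial.aeval D' P (L x) := by
  have hp : ∀ (i : ℕ) (x : M), L ((D ^ i) x) = (D' ^ i) (L x) := fun i => by
    induction i with
    | zero => exact fun _ => rfl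
    | succ i ih =>
      intro x
      rw [pow_succ', pow_succ', Module.End.mul_apply, Module.End.mul_apply, h, ih]
  simp only [Polynomial.aeval_eq_sum_range, LinearMap.sum_apply, LinearMap.smul_apply, map_sum,
    map_smul, hp]

theorem pow_apply_of_commute {M N : Type*} [AddCommGroup M] [Module ℂ M] [AddCommGroup N]
    [Module ℂ N] (L : M →ₗ[ℂ] N) (D : Module.End ℂ M) (D' : Module.End ℂ N)
    (h : ∀ x, L (D x) = D' (L x)) (i : ℕ) (x : M) : L ((D ^ i) x) = (D' ^ i) (L x) := by
  simpa using aeval_apply_of_commute L D D' h (Polynomial.X ^ i) x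

theorem Distr.D_apply (T : Distr) (φ : Test) : Distr.D T φ = -T (testD φ) := rfl

theorem tsupport_testD_subset (φ : Test) : tsupport (testD φ) ⊆ tsupport φ := by
  rw [show ⇑(testD φ) = deriv φ from funext (testD_apply φ)]
  exact tsupport_deriv_subset

/-- Differentiation on `𝓓'₊(ℝ)`. -/
def DPlus.D : Module.End ℂ DPlus where
  toFun T := ⟨Distr.D T, fun φ hφ => by
    rw [Distr.D_apply, T.2 _ ((tsupport_testD_subset φ).trans hφ), neg_zero]⟩
  map_add' _ _ := Subtype.ext (map_add _ _ _)
  map_smul' _ _ := Subtype.ext (map_smul _ _ _)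

theorem DPlus.coe_D (T : DPlus) : (DPlus.D T : Distr) = Distr.D T := rfl

theorem DPlus.coe_aeval_D (P : ℂ[X]) (T : DPlus) :
    (Polynomial.aeval DPlus.D P T : Distr) = Polynomial.aeval Distr.D P (T : Distr) :=
  aeval_apply_of_commute DPlus.subtype DPlus.D Distr.D (fun _ => rfl) P T

theorem DPlus.aeval_D_comm {L : DPlus →ₗ[ℂ] DPlus} (h : ∀ T, L (DPlus.D T) = DPlus.D (L T))
    (P : ℂ[X]) (T : DPlus) :
    L (Polynomial.aeval DPlus.D P T) = Polynomial.aeval DPlus.D P (L T) :=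
  aeval_apply_of_commute (M := DPlus) (N := DPlus) L DPlus.D DPlus.D h P T

/-- The Dirac distribution as an element of `𝓓'₊(ℝ)`. -/
def DPlus.dirac : DPlus :=
  ⟨Distr.dirac, fun φ hφ =>
    (image_eq_zero_of_notMem_tsupport fun h => lt_irrefl (0 : ℝ) (hφ h) : φ 0 = 0)⟩

/-- Moves the equation from all distributions to `𝓓'₊(ℝ)`, where convolution is available. -/
theorem isGreen_iff {P : ℂ[X]} {G : DPlus} :
    IsGreen P G ↔ Polynomial.aeval DPlus.D P G = DPlus.dirac := by
  rw [IsGreen, ← DPlus.coe_aeval_D]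
  exact (Subtype.ext_iff (a2 := DPlus.dirac)).symm

/-- An element of `𝓓'₊(ℝ)` takes equal values on test functions agreeing on `(c, ∞)`, `c < 0`. -/
theorem DPlus.congr (T : DPlus) {φ ψ : Test} {c : ℝ} (hc : c < 0) (h : ∀ x, c < x → φ x = ψ x) :
    (T : Distr) φ = (T : Distr) ψ := by
  rw [← sub_eq_zero, ← map_sub]
  exact DPlus.apply_eq_zero T _ hc fun x hx => by simp [h x hx]

theorem DPlus.ext {S T : DPlus} (h : ∀ φ, (S : Distr) φ = (T : Distr) φ) : S = T :=
  Subtype.ext (ContinuousLinearMap.ext h)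

theorem conv_apply (T S : DPlus) (φ : Test) : (conv T S : Distr) φ = (T : Distr) (convTest S φ) :=
  rfl

/-- The convolution product by `T` on the left, as a linear map. -/
def convRight (T : DPlus) : DPlus →ₗ[ℂ] DPlus where
  toFun S := conv T S
  map_add' S S' := DPlus.ext fun φ => by
    have : convTest (S + S') φ = convTest S φ + convTest S' φ := by
      ext x
      simp [convTest_apply, mul_add]
    simp only [conv_apply, this, map_add]
    rfl
  map_smul' c S := DPlus.ext fun φ => by
    have : convTest (c • S) φ = c • convTest S φ := by
      ext x
      simp [convTest_apply, mul_left_comm]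
    simp only [conv_apply, this, map_smul]
    rfl

/-- The convolution product by `S` on the right, as a linear map. -/
def convLeft (S : DPlus) : DPlus →ₗ[ℂ] DPlus where
  toFun T := conv T S
  map_add' _ _ := rfl
  map_smul' _ _ := rfl

theorem testD_reflShift (x : ℝ) (φ : Test) : testD (reflShift x φ) = -reflShift x (testD φ) := by
  ext y
  have h := iteratedDeriv_coe_reflShift x φ 1 y
  rw [iteratedDeriv_one] at h
  rw [testD_apply, h]
  simp

theorem testD_shift (x : ℝ) (φ : Test) : testD (shift x φ) = shift x (testD φ) := by
  ext y
  rw [testD_apply, shift_apply, testD_apply]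
  exact deriv_comp_const_add (φ : ℝ → ℂ) x y

/-- A translate is a reflected translate of the reflection, at the point `-x`. The sign from the
inner `-x` cancels the sign from differentiating a reflection. -/
theorem Distr.hasDerivAt_shift (T : Distr) (φ : Test) (x : ℝ) :
    HasDerivAt (fun x => T (shift x φ)) (T (shift x (testD φ))) x := by
  have h := (T.hasDerivAt_reflShift (refl φ) (-x)).scomp x (hasDerivAt_neg x)
  have e : reflShift (-x) (testD (refl φ)) = -shift x (testD φ) := by
    rw [shift_eq, refl, refl, testD_reflShift]
    ext
    simp
  rw [e, map_neg, smul_neg, neg_smul, one_smul, neg_neg] at h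
  refine h.congr_of_eventuallyEq (Filter.Eventually.of_forall fun y => ?_)
  exact congrArg T (shift_eq y φ)

/-- `T ⋆ S' = (T ⋆ S)'`. -/
theorem convRight_D (T S : DPlus) : convRight T (DPlus.D S) = DPlus.D (convRight T S) :=
  DPlus.ext fun φ => by
    change (T : Distr) (convTest (DPlus.D S) φ) = -(T : Distr) (convTest S (testD φ))
    rw [← map_neg]
    -- The derivative falls on the inner pairing with `S` and leaves the cutoff alone, so the two
    -- test functions agree everywhere.
    congr 1
    ext x
    rw [convTest_apply, DPlus.coe_D, Distr.D_apply, testD_shift]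
    simp [convTest_apply]

/-- `T' ⋆ S = (T ⋆ S)'`. -/
theorem convLeft_D (S T : DPlus) : convLeft S (DPlus.D T) = DPlus.D (convLeft S T) :=
  DPlus.ext fun φ => by
    change -(T : Distr) (testD (convTest S φ)) = -(T : Distr) (convTest S (testD φ))
    congr 1
    -- Here the cutoff itself gets differentiated. It equals `1` on `(-1/2, ∞)`, so its derivative
    -- vanishes there, and `T` depends only on the values on this half-line.
    refine DPlus.congr T (c := -1 / 2) (by norm_num) fun x hx => ?_
    rw [testD_apply, convTest_apply, cutoff_of_ge hx.le, one_mul]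
    refine (((S : Distr).hasDerivAt_shift φ x).congr_of_eventuallyEq ?_).deriv
    filter_upwards [Ioi_mem_nhds hx] with y hy
    rw [convTest_apply, cutoff_of_ge (le_of_lt hy), one_mul]

theorem conv_dirac (T : DPlus) : conv T DPlus.dirac = T :=
  DPlus.ext fun φ => DPlus.congr T (c := -1 / 2) (by norm_num) fun x hx => by
    rw [convTest_apply, cutoff_of_ge hx.le, one_mul]
    change shift x φ 0 = φ x
    rw [shift_apply, add_zero]

/-- The cutoff equals `1` at the origin. The two unit laws are checked separately, so commutativity
of the convolution is not required. -/
theorem dirac_conv (S : DPlus) : conv DPlus.dirac S = S :=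
  DPlus.ext fun φ => by
    change convTest S φ 0 = _
    rw [convTest_apply, cutoff_of_ge (by norm_num), one_mul]
    congr 1
    ext y
    simp

/-! ### The Green function -/

theorem Test.integrable_mul (φ : Test) (f : Smooth) :
    MeasureTheory.Integrable fun x => φ x * f x :=
  (φ.continuous.mul (Smooth.smooth_coe f).continuous).integrable_of_hasCompactSupport
    φ.hasCompactSupport.mul_right

theorem integralAgainst_indicator_Ioi (f : Smooth) (φ : Test) :
    TestFunction.integralAgainstBilinCLM (ContinuousLinearMap.mul ℂ ℂ)
      MeasureTheory.volume ((Set.Ioi 0).indicator (f : ℝ → ℂ)) φ =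
        ∫ x in Set.Ioi (0 : ℝ), φ x * f x := by
  refine (TestFunction.integralAgainstBilinCLM_eq_integral ?_).trans ?_
  · exact ((Smooth.smooth_coe f).continuous.locallyIntegrable.indicator
      measurableSet_Ioi).locallyIntegrableOn _
  · rw [← MeasureTheory.integral_indicator measurableSet_Ioi]
    congr 1
    ext x
    by_cases hx : x ∈ Set.Ioi (0 : ℝ) <;> simp [hx]

/-- The distribution `φ ↦ ∫_0^∞ φ(x) f(x) dx`. -/
def DPlus.heavisideMul (f : Smooth) : DPlus :=
  ⟨TestFunction.integralAgainstBilinCLM (ContinuousLinearMap.mul ℂ ℂ)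
      MeasureTheory.volume ((Set.Ioi 0).indicator (f : ℝ → ℂ)), fun φ hφ => by
    refine (integralAgainst_indicator_Ioi f φ).trans
      (MeasureTheory.setIntegral_eq_zero_of_forall_eq_zero fun x hx => ?_)
    rw [image_eq_zero_of_notMem_tsupport
      fun h => lt_asymm (show x < 0 from hφ h) (show 0 < x from hx), zero_mul]⟩

theorem DPlus.heavisideMul_apply (f : Smooth) (φ : Test) :
    (DPlus.heavisideMul f : Distr) φ = ∫ x in Set.Ioi (0 : ℝ), φ x * f x :=
  integralAgainst_indicator_Ioi f φ

/-- The Green function of `d/dt - a` is `exp(a x)` cut off to `(0, ∞)`. Integrating `(φ(x) exp(a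
x))'` over the half-line leaves the boundary term `-φ(0)`; the limit at infinity is `0` by compact
support. -/
theorem DPlus.D_heavisideMul_expo (a : ℂ) :
    DPlus.D (DPlus.heavisideMul (Smooth.expo a)) - a • DPlus.heavisideMul (Smooth.expo a) =
      DPlus.dirac :=
  DPlus.ext fun φ => by
    change -(DPlus.heavisideMul (Smooth.expo a) : Distr) (testD φ) -
      a * (DPlus.heavisideMul (Smooth.expo a) : Distr) φ = φ 0
    have i1 := (Test.integrable_mul (testD φ) (Smooth.expo a)).integrableOn (s := Set.Ioi 0)
    have i2 := (Test.integrable_mul φ (a • Smooth.expo a)).integrableOn (s := Set.Ioi 0)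
    have h := MeasureTheory.integral_Ioi_of_hasDerivAt_of_tendsto' (a := 0) (m := 0)
      (fun x _ => (φ.hasDerivAt x).mul (Smooth.hasDerivAt (Smooth.expo a) x))
      (by rw [Smooth.D_expo]; exact i1.add i2) ?_
    · rw [Smooth.D_expo, MeasureTheory.integral_add i1 i2] at h
      have e : ∫ x in Set.Ioi (0 : ℝ), φ x * (a • Smooth.expo a) x =
          a * ∫ x in Set.Ioi (0 : ℝ), φ x * Smooth.expo a x := by
        rw [← MeasureTheory.integral_const_mul]
        refine MeasureTheory.integral_congr_ae (Filter.Eventually.of_forall fun x => ?_)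
        exact mul_left_comm (φ x) a (Smooth.expo a x)
      have e0 : Smooth.expo a 0 = 1 := by simp [Smooth.expo_apply]
      rw [e] at h
      simp only [Pi.mul_apply, e0, mul_one] at h
      rw [DPlus.heavisideMul_apply, DPlus.heavisideMul_apply]
      linear_combination -h
    · obtain ⟨R, -, hR⟩ := φ.exists_radius
      refine tendsto_const_nhds.congr' ?_
      filter_upwards [Filter.eventually_gt_atTop R] with x hx
      simp [hR x (hx.trans_le (le_abs_self x))]

/-- With `E` the Green function of `d/dt - a` and `G` that of `Q(d/dt)`, one has `Q(d/dt)(E ⋆ G) = E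
⋆ δ = E`, so `E ⋆ G` is a Green function of the product. A nonzero constant polynomial is handled by
a multiple of `δ`. -/
theorem exists_isGreen {P : ℂ[X]} {k : ℕ} (hP : P.degree = (k : WithBot ℕ)) :
    ∃ G : DPlus, IsGreen P G := by
  simp only [isGreen_iff]
  induction k generalizing P with
  | zero =>
    refine ⟨(P.coeff 0)⁻¹ • DPlus.dirac, ?_⟩
    rw [aeval_apply_eq_sum (M := DPlus) DPlus.D hP]
    simp [smul_smul, mul_inv_cancel₀ (coeff_ne_zero_of_degree_eq hP)]
  | succ k ih =>
    obtain ⟨a, Q, hQ, rfl⟩ := exists_eq_X_sub_C_mul hP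
    obtain ⟨G, hG⟩ := ih hQ
    refine ⟨convRight (DPlus.heavisideMul (Smooth.expo a)) G, ?_⟩
    rw [aeval_X_sub_C_mul_apply (M := DPlus), ← DPlus.aeval_D_comm (convRight_D _), hG]
    change DPlus.D (conv _ _) - a • conv _ _ = _
    rw [conv_dirac, DPlus.D_heavisideMul_expo]

/-- Differentiating the left factor: `P(d/dt)(G ⋆ T) = (P(d/dt) G) ⋆ T = δ ⋆ T = T`. -/
theorem IsGreen.aeval_conv {P : ℂ[X]} {G : DPlus} (hG : IsGreen P G) (T : DPlus) :
    Polynomial.aeval DPlus.D P (conv G T) = T := by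
  refine (DPlus.aeval_D_comm (convLeft_D T) P G).symm.trans ?_
  rw [isGreen_iff.1 hG]
  exact dirac_conv T

/-- Computing `P(d/dt)(G ⋆ G')` through the left factor gives `G'`, and through the right factor
gives `G`. -/
theorem IsGreen.unique {P : ℂ[X]} {G G' : DPlus} (hG : IsGreen P G) (hG' : IsGreen P G') :
    G = G' := by
  have h1 := hG.aeval_conv G'
  have h2 := (DPlus.aeval_D_comm (convRight_D G) P G').symm
  rw [isGreen_iff.1 hG'] at h2
  exact (conv_dirac G).symm.trans (h2.symm.trans h1)

/-! ### The canonical embedding -/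

theorem Distr.D_ofSmooth (f : Smooth) : Distr.ofSmooth (Smooth.D f) = Distr.D (Distr.ofSmooth f) := by
  ext φ
  rw [Distr.D_apply, Distr.ofSmooth_apply, Distr.ofSmooth_apply]
  exact MeasureTheory.integral_mul_deriv_eq_deriv_mul_of_integrable (fun x _ => φ.hasDerivAt x)
    (fun x _ => Smooth.hasDerivAt f x) (φ.integrable_mul _) ((testD φ).integrable_mul _)
    (φ.integrable_mul _)

/-- The inclusion of the smooth functions into the distributions, as a linear map. -/
def Distr.ofSmoothLinear : Smooth →ₗ[ℂ] Distr where
  toFun := Distr.ofSmooth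
  map_add' f g := by
    ext φ
    change _ = Distr.ofSmooth f φ + Distr.ofSmooth g φ
    simp only [Distr.ofSmooth_apply]
    rw [← MeasureTheory.integral_add (φ.integrable_mul f) (φ.integrable_mul g)]
    exact MeasureTheory.integral_congr_ae (Filter.Eventually.of_forall fun x =>
      mul_add (φ x) (f x) (g x))
  map_smul' c f := by
    ext φ
    change _ = c * Distr.ofSmooth f φ
    simp only [Distr.ofSmooth_apply]
    rw [← MeasureTheory.integral_const_mul]
    exact MeasureTheory.integral_congr_ae (Filter.Eventually.of_forall fun x =>
      mul_left_comm (φ x) c (f x))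

theorem Distr.aeval_D_ofSmooth (P : ℂ[X]) (f : Smooth) :
    Polynomial.aeval Distr.D P (Distr.ofSmooth f) = Distr.ofSmooth (Polynomial.aeval Smooth.D P f) :=
  (aeval_apply_of_commute Distr.ofSmoothLinear Smooth.D Distr.D Distr.D_ofSmooth P f).symm

section Algebra

variable (U : TestUltrafilter)

/-- The sign in the duality definition of `T'` cancels the sign from differentiating `φ(x - ·)`. The
identity holds for every `φ`, so `ι` commutes with `d/dt` on representatives. -/
theorem Distr.reg_D (T : Distr) (φ : Test) : (Distr.D T).reg φ = Smooth.D (T.reg φ) :=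
  Smooth.ext fun x => by
    rw [Smooth.D_apply_of_hasDerivAt (T.hasDerivAt_reflShift φ x), Distr.reg_apply, Distr.D_apply,
      testD_reflShift, map_neg, neg_neg]

theorem embed_D (T : Distr) : embed U (Distr.D T) = Ehat.D U (embed U T) := by
  rw [embed, embed, Ehat.D_mk]
  exact congrArg _ (Subtype.ext (funext (T.reg_D)))

/-- The canonical embedding as a linear map. -/
def embedLinear : Distr →ₗ[ℂ] Ehat U where
  toFun := embed U
  map_add' S T := by
    rw [embed, embed, embed, ← map_add]
    rfl
  map_smul' c T := by
    rw [embed, embed, RingHom.id_apply, ← map_smul]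
    rfl

theorem aeval_D_embed (P : ℂ[X]) (T : Distr) :
    Polynomial.aeval (Ehat.D U) P (embed U T) = embed U (Polynomial.aeval Distr.D P T) :=
  (aeval_apply_of_commute (embedLinear U) Distr.D (Ehat.D U) (embed_D U) P T).symm

theorem D_pow_embed_ofSmooth (f : Smooth) (i : ℕ) :
    (Ehat.D U ^ i) (embed U (Distr.ofSmooth f)) = embed U (Distr.ofSmooth ((Smooth.D ^ i) f)) :=
  (pow_apply_of_commute ((embedLinear U).comp Distr.ofSmoothLinear) Smooth.D (Ehat.D U)
    (fun f => (congrArg (embed U) (Distr.D_ofSmooth f)).trans (embed_D U _)) i f).symm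

/-! ### The generalized Wronskian at the origin -/

/-- These are the properties of an approximate identity; the `L¹` bound stands in for positivity.
The index is `n + 1` because `𝓓₀` imposes no condition. -/
theorem TestUltrafilter.eventually_integral (n : ℕ) :
    ∀ᶠ φ in (U.toUltrafilter : Filter Test), radius φ ≤ 1 / ((n : ℝ) + 1) ∧ ∫ x, φ x = 1 ∧
      ∫ x, ‖φ x‖ ≤ 2 := by
  filter_upwards [U.directing_mem (n + 1)] with φ hφ
  rcases hφ with h | ⟨-, -, h1, h2, -, h3, -⟩
  · omega
  · refine ⟨by simpa using h1, h2, h3.trans ?_⟩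
    have : 1 / ((n + 1 : ℕ) : ℝ) ≤ 1 := by
      rw [div_le_one (by positivity)]
      push_cast
      linarith [(Nat.cast_nonneg n : (0 : ℝ) ≤ n)]
    linarith

/-- The regularizations of a smooth function converge to it pointwise. -/
theorem tendsto_reg_ofSmooth (g : Smooth) (x : ℝ) :
    Filter.Tendsto (fun φ => (Distr.ofSmooth g).reg φ x) (U.toUltrafilter : Filter Test)
      (nhds (g x)) := by
  refine Metric.tendsto_nhds.2 fun ε hε => ?_
  -- The `L¹` norm of `φ` is at most `2`, so an oscillation of `ε / 4` gives an error of at most `ε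
  -- / 2`.
  obtain ⟨d, hd, hg⟩ := Metric.continuous_iff.1 (Smooth.smooth_coe g).continuous x (ε / 4)
    (by positivity)
  obtain ⟨n, hn⟩ := exists_nat_one_div_lt hd
  filter_upwards [U.eventually_integral n] with φ ⟨h1, h2, h3⟩
  have e1 : ∫ y, reflShift x φ y = 1 :=
    (MeasureTheory.integral_sub_left_eq_self φ MeasureTheory.volume x).trans h2
  have e2 : ∫ y, ‖reflShift x φ y‖ ≤ 2 :=
    (MeasureTheory.integral_sub_left_eq_self (fun y => ‖φ y‖) MeasureTheory.volume x).trans_le h3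
  have i1 : MeasureTheory.Integrable (reflShift x φ) :=
    (reflShift x φ).continuous.integrable_of_hasCompactSupport (reflShift x φ).hasCompactSupport
  have e3 : (Distr.ofSmooth g).reg φ x - g x = ∫ y, reflShift x φ y * (g y - g x) := by
    simp only [mul_sub]
    rw [MeasureTheory.integral_sub ((reflShift x φ).integrable_mul g) (i1.mul_const _),
      MeasureTheory.integral_mul_const, e1, one_mul, Distr.reg_apply, Distr.ofSmooth_apply]
  rw [dist_eq_norm, e3]
  have h4 : ∫ y, ‖reflShift x φ y‖ * (ε / 4) ≤ 2 * (ε / 4) := by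
    rw [MeasureTheory.integral_mul_const]
    gcongr
  refine lt_of_le_of_lt (MeasureTheory.norm_integral_le_of_norm_le (i1.norm.mul_const (ε / 4))
    (Filter.Eventually.of_forall fun y => ?_)) (h4.trans_lt (by linarith))
  rw [norm_mul]
  -- Where the kernel does not vanish, `|x - y| ≤ R_φ < d`, and the continuity of `g` at `x`
  -- applies.
  by_cases hy : reflShift x φ y = 0
  · simp [hy]
  · refine mul_le_mul_of_nonneg_left ?_ (norm_nonneg _)
    rw [← dist_eq_norm]
    refine (hg y ?_).le
    rw [dist_comm, Real.dist_eq]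
    exact ((abs_le_radius φ hy).trans h1).trans_lt hn

/-- A negligible net is almost everywhere at most `R_φ`, which becomes arbitrarily small along the
ultrafilter, so it cannot have a nonzero limit. -/
theorem Chat.mk_ne_zero_of_tendsto {A : moderateC U} {a : ℂ} (ha : a ≠ 0)
    (h : Filter.Tendsto (A : Test → ℂ) (U.toUltrafilter : Filter Test) (nhds a)) :
    Chat.mk U A ≠ 0 := by
  intro h0
  rw [Chat.mk_eq_zero] at h0
  obtain ⟨n, hn⟩ := exists_nat_one_div_lt (norm_pos_iff.2 ha)
  obtain ⟨φ, h1, h2, h3⟩ := ((h.norm.eventually_const_lt hn).and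
    ((h0 1).and (U.eventually_radius n))).exists
  rw [pow_one] at h2
  exact absurd (h1.trans_le (h2.trans h3.2)) (lt_irrefl _)

/-- The value at the origin of the Wronskian, as a determinant of values. -/
theorem eval_wronskian {k : ℕ} (y : Fin k → Ehat U) (x : ℝ) :
    Ehat.eval U x (wronskian U y) =
      (Matrix.of fun i n : Fin k => Ehat.eval U x ((Ehat.D U ^ (i : ℕ)) (y n))).det := by
  rw [wronskian, RingHom.map_det]
  rfl

/-- The value of a moderate net at a test function. -/
def moderateC.evalAt (φ : Test) : moderateC U →+* ℂ :=
  (Pi.evalRingHom (fun _ : Test => ℂ) φ).comp (moderateC U).toSubring.subtype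

/-- Pointwise convergence of the regularizations of each derivative, with continuity of the
determinant, makes the net of Wronskians converge to the classical one. No comparison of `ι(y)` with
the constant net of `y` is needed. -/
theorem IsFundamentalSystem.eval_wronskian_ne_zero {P : ℂ[X]} {k : ℕ}
    (hP : P.degree = (k : WithBot ℕ)) {y : Fin k → Smooth} (hy : IsFundamentalSystem P y) :
    Ehat.eval U 0 (wronskian U fun n => embed U (Distr.ofSmooth (y n))) ≠ 0 := by
  -- A lift of the Wronskian matrix to the ring of moderate nets. The determinant then commutes both
  -- with passing to classes and with evaluating at each `φ`.
  let B : Matrix (Fin k) (Fin k) (moderateC U) := Matrix.of fun i n => evalNet U 0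
    ⟨(Distr.ofSmooth ((Smooth.D ^ (i : ℕ)) (y n))).reg, reg_mem_moderateE U _⟩
  have e : Ehat.eval U 0 (wronskian U fun n => embed U (Distr.ofSmooth (y n))) =
      Chat.mk U B.det := by
    rw [eval_wronskian, RingHom.map_det]
    simp only [D_pow_embed_ofSmooth]
    rfl
  rw [e]
  refine Chat.mk_ne_zero_of_tendsto U (hy.det_ne_zero hP) ?_
  have e2 : ((B.det : moderateC U) : Test → ℂ) =
      fun φ => (Matrix.of fun i n : Fin k =>
        (Distr.ofSmooth ((Smooth.D ^ (i : ℕ)) (y n))).reg φ 0).det :=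
    funext fun φ => RingHom.map_det (moderateC.evalAt U φ) B
  rw [e2]
  refine ((continuous_id.matrix_det).tendsto (Smooth.wronskianMatrix y)).comp ?_
  exact tendsto_pi_nhds.2 fun i => tendsto_pi_nhds.2 fun n => tendsto_reg_ofSmooth U _ 0

/-! ### Solution of the initial value problem -/

/-- By linearity over `Ĉ` it suffices to treat each term `ι(G ⋆ S)` of one representation of `f`,
where `P(d/dt)` passes under `ι` and `P(d/dt)(G ⋆ S) = S`. -/
theorem IsGreen.aeval_starHat {P : ℂ[X]} {G : DPlus} (hG : IsGreen P G)
    (f : spanHat U (DPlus : Set Distr)) :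
    Polynomial.aeval (Ehat.D U) P (starHat U G f : Ehat U) = f := by
  obtain ⟨l, hl⟩ := exists_rep U f
  rw [starHat_eq U G f l hl, ← hl, Finsupp.sum, Finsupp.sum, map_sum]
  refine Finset.sum_congr rfl fun S _ => ?_
  rw [Ehat.aeval_D_smul, aeval_D_embed, ← DPlus.coe_aeval_D, hG.aeval_conv]

/-- Cramer's rule. -/
theorem sum_cramer_add_eq_zero {K ι : Type*} [Field K] [Fintype ι] [DecidableEq ι]
    {A : Matrix ι ι K} (hA : A.det ≠ 0) (b : ι → K) (i : ι) :
    ∑ n, -(A.cramer b n / A.det) * A i n + b i = 0 := by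
  have hs : ∑ n, A i n * A.cramer b n = A.det * b i := congrFun (Matrix.mulVec_cramer A b) i
  have h1 : ∑ n, -(A.cramer b n / A.det) * A i n = -(A.det)⁻¹ * ∑ n, A i n * A.cramer b n := by
    rw [Finset.mul_sum]
    exact Finset.sum_congr rfl fun n _ => by rw [div_eq_mul_inv]; ring
  rw [h1, hs, ← mul_assoc, neg_mul, inv_mul_cancel₀ hA]
  ring

/-- `G ⋆ f` already satisfies the equation, and adding homogeneous solutions preserves it. The `c n`
solve the linear system that makes the first `k` initial values cancel. -/
theorem IsGreen.isSteadyState {P : ℂ[X]} {k : ℕ} (hP : P.degree = (k : WithBot ℕ)) {G : DPlus}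
    (hG : IsGreen P G) (f : spanHat U (DPlus : Set Distr)) {y : Fin k → Smooth}
    (hy : IsFundamentalSystem P y) (c : Fin k → Chat U)
    (hc : ∀ n, c n =
      -(Ehat.eval U 0 (wronskian U (Function.update
          (fun m => embed U (Distr.ofSmooth (y m))) n (starHat U G f : Ehat U))) /
        Ehat.eval U 0 (wronskian U fun m => embed U (Distr.ofSmooth (y m))))) :
    IsSteadyState U P k (f : Ehat U)
      (∑ n, c n • embed U (Distr.ofSmooth (y n)) + (starHat U G f : Ehat U)) := by
  have hW := hy.eval_wronskian_ne_zero U hP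
  refine ⟨?_, fun i hi => ?_⟩
  · rw [map_add, map_sum, hG.aeval_starHat, Finset.sum_eq_zero, zero_add]
    intro n _
    rw [Ehat.aeval_D_smul, aeval_D_embed, Distr.aeval_D_ofSmooth, hy.2 n,
      show Distr.ofSmooth 0 = 0 from map_zero Distr.ofSmoothLinear,
      show embed U 0 = 0 from map_zero (embedLinear U), smul_zero]
  · set A : Matrix (Fin k) (Fin k) (Chat U) := Matrix.of fun i n =>
      Ehat.eval U 0 ((Ehat.D U ^ (i : ℕ)) (embed U (Distr.ofSmooth (y n)))) with hA
    set b : Fin k → Chat U := fun i =>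
      Ehat.eval U 0 ((Ehat.D U ^ (i : ℕ)) (starHat U G f : Ehat U)) with hb
    have hdet : Ehat.eval U 0 (wronskian U fun m => embed U (Distr.ofSmooth (y m))) = A.det :=
      eval_wronskian U _ 0
    have hcr : ∀ n, c n = -(A.cramer b n / A.det) := fun n => by
      -- Replacing the `n`-th function by `G ⋆ f` replaces the `n`-th column of the Wronskian matrix
      -- by `b`, which is the numerator in Cramer's rule.
      rw [hc n, hdet, eval_wronskian, Matrix.cramer_apply]
      congr 3
      ext i m
      by_cases hm : m = n
      · subst hm
        simp [hb]
      · simp [hm, hA]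
    rw [hdet] at hW
    rw [map_add, map_add, map_sum, map_sum]
    simp only [Ehat.D_pow_smul, Ehat.eval_smul, hcr]
    exact sum_cramer_add_eq_zero hW b ⟨i, hi⟩

end Algebra

end TodorovVernaeve

end

/-! ### The main theorem -/

theorem mainTheorem1 (U : TestUltrafilter) (P : ℂ[X]) (k : ℕ) (hP : P.degree = (k : WithBot ℕ))
    (f : spanHat U (DPlus : Set Distr)) :
    (∃! y : Ehat U, IsSteadyState U P k (f : Ehat U) y) ∧
    (∃! G : DPlus, IsGreen P G) ∧
    (∃ y : Fin k → Smooth, IsFundamentalSystem P y) ∧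
    ∀ G : DPlus, IsGreen P G → ∀ y : Fin k → Smooth, IsFundamentalSystem P y →
      Ehat.eval U 0 (wronskian U fun n => embed U (Distr.ofSmooth (y n))) ≠ 0 ∧
      ∀ c : Fin k → Chat U,
        (∀ n, c n =
          -(Ehat.eval U 0 (wronskian U (Function.update
              (fun m => embed U (Distr.ofSmooth (y m))) n (starHat U G f : Ehat U))) /
            Ehat.eval U 0 (wronskian U fun m => embed U (Distr.ofSmooth (y m))))) →
        IsSteadyState U P k (f : Ehat U)
          (∑ n, c n • embed U (Distr.ofSmooth (y n)) + (starHat U G f : Ehat U)) := by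
  obtain ⟨G, hG⟩ := exists_isGreen hP
  obtain ⟨y, hy⟩ := exists_isFundamentalSystem hP
  -- One Green function and one fundamental system provide existence, with `c` defined by the
  -- formula. The last clause holds for every such choice.
  exact ⟨⟨_, hG.isSteadyState U hP f hy _ fun _ => rfl, fun z hz =>
      hz.unique U hP (hG.isSteadyState U hP f hy _ fun _ => rfl)⟩,
    ⟨G, hG, fun G' hG' => hG'.unique hG⟩, ⟨y, hy⟩, fun G' hG' y' hy' =>
      ⟨hy'.eval_wronskian_ne_zero U hP, hG'.isSteadyState U hP f hy'⟩⟩
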